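/- **Conventions.** Let $k$ be a field of characteristic $p>2$ and $\mathfrak g$ a $2$-dimensional Lie algebra over $k$. The enveloping algebra $U(\mathfrak g)$ is a Hopf algebra in which the elements of $\mathfrak g$ are primitive; $\hat{\mathfrak g}\subseteq U(\mathfrak g)$ is the span of all $v^{p^r}$ with $v\in\mathfrak g$, $r\ge 0$; $[s,t]=st-ts$ in $U(\mathfrak g)$. For a Hopf algebra $A$, an algebra endomorphism $\tau$ of $A$ and a $\tau$-derivation $\delta$ (so $\delta(st)=\tau(s)\delta(t)+\delta(s)t$), the Ore extension $A[z;\tau,\delta]$ is the algebra that is free as a left $A$-module on $1,z,z^2,\dots$, with $zs=\tau(s)z+\delta(s)$ for $s\in A$. A *generalized Hopf-Ore extension* of $A$, determined by $r_1,r_2,x,y\in A$, is a Hopf algebra structure on $H=A[z;\tau,\delta]$ such that $A$ is a Hopf subalgebra and $\Delta z=z\otimes r_1+x\otimes y+r_2\otimes z$. If moreover $r_1,r_2$ are group-like, $\Delta x=x\otimes 1+r_2\otimes x$, $\Delta y=y\otimes r_1+1\otimes y$, $x=0\Leftrightarrow y=0$, and $\tau(s)=\sum\chi(s_1)\,\mathrm{Ad}_{r_1}(s_2)$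 for a character (algebra map) $\chi:A\to k$, where $\mathrm{Ad}_s(t)=\sum s_1tS(s_2)$, we write $H=A(\chi,r_1,r_2,x,y,\delta)$; for $A=U(\mathfrak g)$ we write $\chi=0$ if $\chi$ vanishes on $\mathfrak g$. Two generalized Hopf-Ore extensions $H$ of $A$ and $H'$ of $A'$ are isomorphic if there is a Hopf algebra isomorphism $H\to H'$ that takes $A$ onto $A'$. **Proposition.** There is a basis $a,b$ of $\mathfrak g$ with $[a,b]=0$ or $[a,b]=a$. Let $H$ be a generalized Hopf-Ore extension of $U(\mathfrak g)$ determined by $r_1,r_2,x,y$. Then $r_1=r_2=1$. If $\Delta x=x\otimes 1+r_2\otimes x$ and $\Delta y=y\otimes r_1+1\otimes y$, then $x,y\in\hat{\mathfrak g}$, and for every basis $a,b$ as above they can be written uniquely as $x=\sum_i\alpha_ia^{p^i}+\sum_i\alpha_i'b^{p^i}$, $y=\sum_i\beta_ia^{p^i}+\sum_i\beta'_ib^{p^i}$ (finite sums, coefficients in $k$). In such expansions put $\alpha'=-\sum_i\alpha'_i$ and $\beta'=-\sum_i\beta_i'$. For every basis $a,b$ of $\mathfrak g$ with $[a,b]=0$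 or $[a,b]=a$, $H$ is isomorphic, as a generalized Hopf-Ore extension, to one of the following, where $x,y$ now denote the elements in the new data and $\alpha_i,\alpha'_i,\beta_i,\beta'_i$ their coefficients: (a) $U(\mathfrak g)(\chi,1,1,0,0,\delta)$ with $[a,b]=0$ or $[a,b]=a$, where $\chi$ is a character, $\delta(\mathfrak g)\subseteq\hat{\mathfrak g}$ and $\delta([a,b])=[\delta(a),b]+[a,\delta(b)]+\chi(a)\delta(b)-\chi(b)\delta(a)$. (b) $U(\mathfrak g)(0,1,1,x,y,\delta)$ with $[a,b]=0$, $0\ne x,y\in\hat{\mathfrak g}$, $kx\ne ky$ and $\delta(\mathfrak g)\subseteq\hat{\mathfrak g}$. (c) $U(\mathfrak g)(0,1,1,x,y,\delta)$ with $[a,b]=a$, $0\ne x,y\in\hat{\mathfrak g}$, $kx\ne ky$, $\alpha_0=\beta_0=\alpha'=\beta'=0$, $\delta(\mathfrak g)\subseteq\hat{\mathfrak g}$ and $\delta(a)=[\delta(a),b]+[a,\delta(b)]$. (d) $U(\mathfrak g)(\chi,1,1,x,y,\delta)$ with $[a,b]=a$, $\chi(a)=0$, $\chi(b)=1$, $0\ne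 x,y\in\hat{\mathfrak g}$, $kx\ne ky$, $2\delta(a)=[\delta(a),b]+[a,\delta(b)]$, and one of: (i) $x=\alpha_0a$, and $\delta(a)-\frac12\alpha_0\beta'a^2,\ \delta(b)-\frac12\alpha_0\beta_0a^2\in\hat{\mathfrak g}$; (ii) $y=\beta_0a$, and $\delta(a)-\frac12\alpha'\beta_0a^2,\ \delta(b)-\frac12\alpha_0\beta_0a^2\in\hat{\mathfrak g}$; (iii) $\alpha'=0$, $y-\beta_0a=\lambda(x-\alpha_0a)\ne0$ for some $\lambda\in k\setminus\{0\}$, and $\delta(a)\in\hat{\mathfrak g}$, $\delta(b)+\frac12(xy-\beta_0xa-\alpha_0ay)\in\hat{\mathfrak g}$. Up to isomorphism of Hopf algebras, the Hopf algebras in (a) with $\delta(\mathfrak g)\subseteq\mathfrak g$ are exactly the enveloping algebras of the $3$-dimensional Lie algebras over $k$ that have a $2$-dimensional Lie subalgebra: each such Hopf algebra is isomorphic to $U(M)$ for such a Lie algebra $M$, and for each such $M$ and each $2$-dimensional Lie subalgebra $N\subseteq M$, $U(M)$ is itself, for some $z\in U(M)$, an extension of $U(N)$ of type (a) with $\delta(N)\subseteq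 N$. -/

import Mathlib

open scoped TensorProduct

universe u v w

namespace HopfOre

noncomputable section

/-! ## The Hopf algebra structure on an enveloping algebra: elements of `L` are primitive -/

section Enveloping

attribute [local instance 100] LieRing.ofAssociativeRing

variable (k : Type u) [Field k] (L : Type v) [LieRing L] [LieAlgebra k L]

/-- The Lie homomorphism `v ↦ v ⊗ 1 + 1 ⊗ v`. -/
def primitiveLieHom :
    L →ₗ⁅k⁆ UniversalEnvelopingAlgebra k L ⊗[k] UniversalEnvelopingAlgebra k L where
  toFun v := UniversalEnvelopingAlgebra.ι k v ⊗ₜ[k] 1 + 1 ⊗ₜ[k] UniversalEnvelopingAlgebra.ι k v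
  map_add' v w := by
    simp only [map_add, TensorProduct.add_tmul, TensorProduct.tmul_add]; abel
  map_smul' c v := by
    simp only [map_smul, TensorProduct.smul_tmul', TensorProduct.tmul_smul, smul_add,
      RingHom.id_apply]
  map_lie' {v w} := by
    simp only [LieHom.map_lie, LieRing.of_associative_ring_bracket, mul_add, add_mul,
      Algebra.TensorProduct.tmul_mul_tmul, mul_one, one_mul, TensorProduct.sub_tmul,
      TensorProduct.tmul_sub]
    abel

/-- The comultiplication of `U(L)`. -/
def envComul : UniversalEnvelopingAlgebra k L →ₐ[k]
    UniversalEnvelopingAlgebra k L ⊗[k] UniversalEnvelopingAlgebra k L :=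
  UniversalEnvelopingAlgebra.lift k (primitiveLieHom k L)

/-- The counit of `U(L)`. -/
def envCounit : UniversalEnvelopingAlgebra k L →ₐ[k] k :=
  UniversalEnvelopingAlgebra.lift k (0 : L →ₗ⁅k⁆ k)

/-- The Lie homomorphism `v ↦ -v` into the opposite algebra. -/
def negLieHom : L →ₗ⁅k⁆ (UniversalEnvelopingAlgebra k L)ᵐᵒᵖ where
  toFun v := MulOpposite.op (-UniversalEnvelopingAlgebra.ι k v)
  map_add' v w := by
    rw [map_add, neg_add, MulOpposite.op_add]
  map_smul' c v := by
    rw [map_smul, ← smul_neg, MulOpposite.op_smul]; rfl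
  map_lie' {v w} := by
    apply MulOpposite.unop_injective
    simp only [LieHom.map_lie, LieRing.of_associative_ring_bracket, MulOpposite.unop_op,
      MulOpposite.unop_sub, MulOpposite.unop_mul, neg_mul_neg, neg_sub]

/-- The antipode of `U(L)`: the anti-homomorphism with `v ↦ -v` for `v ∈ L`. -/
def envAntipode : UniversalEnvelopingAlgebra k L →ₗ[k] UniversalEnvelopingAlgebra k L :=
  (MulOpposite.opLinearEquiv k).symm.toLinearMap ∘ₗ
    (UniversalEnvelopingAlgebra.lift k (negLieHom k L)).toLinearMap

variable {L}

theorem envComul_ι (v : L) : envComul k L (UniversalEnvelopingAlgebra.ι k v) =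
    UniversalEnvelopingAlgebra.ι k v ⊗ₜ[k] 1 + 1 ⊗ₜ[k] UniversalEnvelopingAlgebra.ι k v :=
  UniversalEnvelopingAlgebra.lift_ι_apply k _ v

theorem envCounit_ι (v : L) : envCounit k L (UniversalEnvelopingAlgebra.ι k v) = 0 :=
  UniversalEnvelopingAlgebra.lift_ι_apply k _ v

theorem envAntipode_ι (v : L) : envAntipode k L (UniversalEnvelopingAlgebra.ι k v) =
    -UniversalEnvelopingAlgebra.ι k v := by
  simp only [envAntipode, LinearMap.comp_apply, AlgHom.toLinearMap_apply,
    UniversalEnvelopingAlgebra.lift_ι_apply]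
  rfl

theorem envAntipode_one : envAntipode k L 1 = 1 := by
  simp [envAntipode]

theorem envAntipode_mul (s t : UniversalEnvelopingAlgebra k L) :
    envAntipode k L (s * t) = envAntipode k L t * envAntipode k L s := by
  simp [envAntipode]

theorem env_hom_ext {B : Type w} [Ring B] [Algebra k B]
    {f g : UniversalEnvelopingAlgebra k L →ₐ[k] B}
    (h : ∀ v : L, f (UniversalEnvelopingAlgebra.ι k v) = g (UniversalEnvelopingAlgebra.ι k v)) :
    f = g :=
  UniversalEnvelopingAlgebra.hom_ext k (LieHom.ext h)

/-- A subalgebra of `U(L)` that contains `L` is everything. -/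
theorem mem_of_ι_mem (S : Subalgebra k (UniversalEnvelopingAlgebra k L))
    (hS : ∀ v : L, UniversalEnvelopingAlgebra.ι k v ∈ S) (t : UniversalEnvelopingAlgebra k L) :
    t ∈ S := by
  let f : L →ₗ⁅k⁆ S :=
    { toFun := fun v => ⟨UniversalEnvelopingAlgebra.ι k v, hS v⟩
      map_add' := fun v w => Subtype.ext (map_add _ v w)
      map_smul' := fun c v => Subtype.ext (map_smul _ c v)
      map_lie' := fun {v w} => Subtype.ext (by
        simp [LieRing.of_associative_ring_bracket]) }
  have h : S.val.comp (UniversalEnvelopingAlgebra.lift k f) = AlgHom.id k _ := by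
    apply UniversalEnvelopingAlgebra.hom_ext
    ext v
    change ((UniversalEnvelopingAlgebra.lift k f (UniversalEnvelopingAlgebra.ι k v) : S) :
      UniversalEnvelopingAlgebra k L) = UniversalEnvelopingAlgebra.ι k v
    rw [UniversalEnvelopingAlgebra.lift_ι_apply]
    rfl
  have h2 : ((UniversalEnvelopingAlgebra.lift k f t : S) : UniversalEnvelopingAlgebra k L) = t :=
    congrArg (fun F : UniversalEnvelopingAlgebra k L →ₐ[k] UniversalEnvelopingAlgebra k L => F t) h
  rw [← h2]
  exact Subtype.property _

variable (L)

instance instBialgebraEnveloping : Bialgebra k (UniversalEnvelopingAlgebra k L) :=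
  Bialgebra.ofAlgHom (envComul k L) (envCounit k L)
    (by
      refine env_hom_ext k fun v => ?_
      change Algebra.TensorProduct.assoc k k k _ _ _ (Algebra.TensorProduct.map _ _
        (envComul k L (UniversalEnvelopingAlgebra.ι k v))) = Algebra.TensorProduct.map _ _
        (envComul k L (UniversalEnvelopingAlgebra.ι k v))
      simp only [envComul_ι, map_add, Algebra.TensorProduct.map_tmul, map_one, AlgHom.id_apply,
        TensorProduct.add_tmul, TensorProduct.tmul_add, Algebra.TensorProduct.one_def,
        Algebra.TensorProduct.assoc_tmul]
      abel)
    (by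
      refine env_hom_ext k fun v => ?_
      change Algebra.TensorProduct.map _ _ (envComul k L (UniversalEnvelopingAlgebra.ι k v)) =
        (1 : k) ⊗ₜ[k] UniversalEnvelopingAlgebra.ι k v
      simp [-UniversalEnvelopingAlgebra.ι_apply, envComul_ι, envCounit_ι])
    (by
      refine env_hom_ext k fun v => ?_
      change Algebra.TensorProduct.map _ _ (envComul k L (UniversalEnvelopingAlgebra.ι k v)) =
        UniversalEnvelopingAlgebra.ι k v ⊗ₜ[k] (1 : k)
      simp [-UniversalEnvelopingAlgebra.ι_apply, envComul_ι, envCounit_ι])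

/-- `s ⊗ t ↦ S(s) t`. -/
def leftFold : UniversalEnvelopingAlgebra k L ⊗[k] UniversalEnvelopingAlgebra k L →ₗ[k]
    UniversalEnvelopingAlgebra k L :=
  LinearMap.mul' k _ ∘ₗ (envAntipode k L).rTensor _

/-- `s ⊗ t ↦ s S(t)`. -/
def rightFold : UniversalEnvelopingAlgebra k L ⊗[k] UniversalEnvelopingAlgebra k L →ₗ[k]
    UniversalEnvelopingAlgebra k L :=
  LinearMap.mul' k _ ∘ₗ (envAntipode k L).lTensor _

variable {L}

theorem leftFold_tmul (s t : UniversalEnvelopingAlgebra k L) :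
    leftFold k L (s ⊗ₜ t) = envAntipode k L s * t := by simp [leftFold]

theorem rightFold_tmul (s t : UniversalEnvelopingAlgebra k L) :
    rightFold k L (s ⊗ₜ t) = s * envAntipode k L t := by simp [rightFold]

theorem leftFold_mul (x y : UniversalEnvelopingAlgebra k L ⊗[k] UniversalEnvelopingAlgebra k L)
    (c : k) (hx : leftFold k L x = algebraMap k _ c) :
    leftFold k L (x * y) = c • leftFold k L y := by
  induction y using TensorProduct.induction_on with
  | zero => simp
  | add y₁ y₂ h₁ h₂ => simp only [mul_add, map_add, h₁, h₂, smul_add]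
  | tmul s t =>
    have key : ∀ x, leftFold k L (x * s ⊗ₜ[k] t) = envAntipode k L s * leftFold k L x * t := by
      intro x
      induction x using TensorProduct.induction_on with
      | zero => simp
      | add x₁ x₂ h₁ h₂ => simp only [mul_add, add_mul, map_add, h₁, h₂]
      | tmul s' t' =>
        simp only [Algebra.TensorProduct.tmul_mul_tmul, leftFold_tmul, envAntipode_mul, mul_assoc]
    rw [key, hx, leftFold_tmul, ← Algebra.commutes, mul_assoc, ← Algebra.smul_def]

theorem rightFold_mul (x y : UniversalEnvelopingAlgebra k L ⊗[k] UniversalEnvelopingAlgebra k L)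
    (c : k) (hy : rightFold k L y = algebraMap k _ c) :
    rightFold k L (x * y) = c • rightFold k L x := by
  induction x using TensorProduct.induction_on with
  | zero => simp
  | add y₁ y₂ h₁ h₂ => simp only [add_mul, map_add, h₁, h₂, smul_add]
  | tmul s t =>
    have key : ∀ y, rightFold k L (s ⊗ₜ[k] t * y) = s * rightFold k L y * envAntipode k L t := by
      intro y
      induction y using TensorProduct.induction_on with
      | zero => simp
      | add x₁ x₂ h₁ h₂ => simp only [mul_add, add_mul, map_add, h₁, h₂]
      | tmul s' t' =>
        simp only [Algebra.TensorProduct.tmul_mul_tmul, rightFold_tmul, envAntipode_mul, mul_assoc]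
    rw [key, hy, rightFold_tmul, ← Algebra.commutes, mul_assoc, ← Algebra.smul_def]

theorem leftFold_comul (t : UniversalEnvelopingAlgebra k L) :
    leftFold k L (envComul k L t) = algebraMap k _ (envCounit k L t) := by
  let S : Subalgebra k (UniversalEnvelopingAlgebra k L) :=
    { carrier := {t | leftFold k L (envComul k L t) = algebraMap k _ (envCounit k L t)}
      mul_mem' := by
        intro s t hs ht
        simp only [Set.mem_ofPred_eq] at hs ht ⊢
        rw [map_mul, leftFold_mul k _ _ _ hs, ht, map_mul, map_mul, Algebra.smul_def]
      add_mem' := by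
        intro s t hs ht
        simp only [Set.mem_ofPred_eq] at hs ht ⊢
        simp only [map_add, hs, ht]
      algebraMap_mem' := by
        intro c
        simp only [Set.mem_ofPred_eq, AlgHom.commutes, Algebra.TensorProduct.algebraMap_apply,
          leftFold_tmul, mul_one, Algebra.algebraMap_self_apply]
        rw [Algebra.algebraMap_eq_smul_one, map_smul, envAntipode_one] }
  refine mem_of_ι_mem k S (fun v => ?_) t
  change leftFold k L (envComul k L _) = algebraMap k _ (envCounit k L _)
  simp [-UniversalEnvelopingAlgebra.ι_apply, envComul_ι, envCounit_ι, leftFold_tmul,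
    envAntipode_ι, envAntipode_one]

theorem rightFold_comul (t : UniversalEnvelopingAlgebra k L) :
    rightFold k L (envComul k L t) = algebraMap k _ (envCounit k L t) := by
  let S : Subalgebra k (UniversalEnvelopingAlgebra k L) :=
    { carrier := {t | rightFold k L (envComul k L t) = algebraMap k _ (envCounit k L t)}
      mul_mem' := by
        intro s t hs ht
        simp only [Set.mem_ofPred_eq] at hs ht ⊢
        rw [map_mul, rightFold_mul k _ _ _ ht, hs, map_mul, map_mul, Algebra.smul_def,
          Algebra.commutes]
      add_mem' := by
        intro s t hs ht
        simp only [Set.mem_ofPred_eq] at hs ht ⊢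
        simp only [map_add, hs, ht]
      algebraMap_mem' := by
        intro c
        simp only [Set.mem_ofPred_eq, AlgHom.commutes, Algebra.TensorProduct.algebraMap_apply,
          rightFold_tmul, envAntipode_one, mul_one, Algebra.algebraMap_self_apply] }
  refine mem_of_ι_mem k S (fun v => ?_) t
  change rightFold k L (envComul k L _) = algebraMap k _ (envCounit k L _)
  simp [-UniversalEnvelopingAlgebra.ι_apply, envComul_ι, envCounit_ι, rightFold_tmul,
    envAntipode_ι, envAntipode_one]

variable (L)

/-- `U(L)` as a Hopf algebra, the elements of `L` being primitive. -/
instance instHopfAlgebraEnveloping : HopfAlgebra k (UniversalEnvelopingAlgebra k L) where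
  antipode := envAntipode k L
  mul_antipode_rTensor_comul := LinearMap.ext (leftFold_comul k)
  mul_antipode_lTensor_comul := LinearMap.ext (rightFold_comul k)

/-- The Hopf algebra homomorphism `U(M) → U(L)` induced by the inclusion of a Lie subalgebra. -/
def envIncl (M : LieSubalgebra k L) :
    UniversalEnvelopingAlgebra k M →ₐc[k] UniversalEnvelopingAlgebra k L :=
  BialgHom.ofAlgHom
    (UniversalEnvelopingAlgebra.lift k ((UniversalEnvelopingAlgebra.ι k).comp M.incl))
    (by
      refine env_hom_ext k fun v => ?_
      change envCounit k L (UniversalEnvelopingAlgebra.lift k _ (UniversalEnvelopingAlgebra.ι k v))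
        = envCounit k M (UniversalEnvelopingAlgebra.ι k v)
      rw [UniversalEnvelopingAlgebra.lift_ι_apply, envCounit_ι]
      exact envCounit_ι k _)
    (by
      refine env_hom_ext k fun v => ?_
      change Algebra.TensorProduct.map _ _ (envComul k M (UniversalEnvelopingAlgebra.ι k v)) =
        envComul k L (UniversalEnvelopingAlgebra.lift k _ (UniversalEnvelopingAlgebra.ι k v))
      rw [envComul_ι, UniversalEnvelopingAlgebra.lift_ι_apply]
      simp only [map_add, Algebra.TensorProduct.map_tmul, map_one]
      rw [UniversalEnvelopingAlgebra.lift_ι_apply]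
      exact (envComul_ι k _).symm)

end Enveloping

/-! ## Generalized Hopf-Ore extensions -/

section Extensions

variable {k : Type u} [Field k]

/-- The algebra `H` with the embedding `i` of `A` and the element `z` is the Ore extension
`A[z; τ, δ]`: `δ` is a `τ`-derivation, `z a = τ(a) z + δ(a)` holds in `H`, and every element of `H`
is `∑ aₙ zⁿ` for exactly one finitely supported family `(aₙ)` in `A` (so `i` is injective). -/
structure IsOreExtension {A : Type v} [Ring A] [Algebra k A] {H : Type w} [Ring H] [Algebra k H]
    (τ : A →ₐ[k] A) (δ : A →ₗ[k] A) (i : A →ₐ[k] H) (z : H) : Prop where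
  derivation : ∀ a b : A, δ (a * b) = τ a * δ b + δ a * b
  relation : ∀ a : A, z * i a = i (τ a) * z + i (δ a)
  basis : Function.Bijective fun f : ℕ →₀ A => f.sum fun n a => i a * z ^ n

variable {A : Type v} [Ring A] [HopfAlgebra k A] {H : Type w} [Ring H] [HopfAlgebra k H]

/-- The Hopf algebra `H` is the Ore extension `A[z; τ, δ]`, it contains `A` as a Hopf subalgebra
(through the bialgebra homomorphism `i`, which respects antipodes automatically), and
`Δ z = z ⊗ r₁ + x ⊗ y + r₂ ⊗ z`. -/
structure IsGeneralizedHopfOre (τ : A →ₐ[k] A) (δ : A →ₗ[k] A) (r₁ r₂ x y : A)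
    (i : A →ₐc[k] H) (z : H) : Prop where
  ore : IsOreExtension τ δ (i : A →ₐ[k] H) z
  comul_z : Coalgebra.comul (R := k) z = z ⊗ₜ[k] i r₁ + i x ⊗ₜ[k] i y + i r₂ ⊗ₜ[k] z

variable (k) in
/-- `x` is `(g, h)`-primitive: `Δ x = x ⊗ g + h ⊗ x`. -/
def IsSkewPrimitive (g h x : A) : Prop :=
  Coalgebra.comul (R := k) x = x ⊗ₜ[k] g + h ⊗ₜ[k] x

/-- `Ad_a(b) = ∑ a₁ b S(a₂)`, as a linear map in `b`. -/
def Ad (a : A) : A →ₗ[k] A :=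
  (TensorProduct.lift ((LinearMap.llcomp k A A A).flip.compl₁₂
    (LinearMap.mul k A) ((LinearMap.mul k A).flip ∘ₗ HopfAlgebra.antipode k)))
    (Coalgebra.comul (R := k) a)

/-- The map `a ↦ ∑ χ(a₁) Ad_r(a₂)`. -/
def twist (χ : A →ₐ[k] k) (r : A) : A →ₗ[k] A :=
  TensorProduct.lift ((LinearMap.lsmul k A).comp χ.toLinearMap |>.compl₂ (Ad (k := k) r)) ∘ₗ
    Coalgebra.comul

/-- `H`, with the embedding `i` and the element `z`, is the generalized Hopf-Ore extension in normal
form `A(χ, r₁, r₂, x, y, δ)`: `τ(a) = ∑ χ(a₁) Ad_{r₁}(a₂)`, the elements `r₁`, `r₂` are group-like,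
`x` is `(1, r₂)`-primitive, `y` is `(r₁, 1)`-primitive, and `x = 0` if and only if `y = 0`. -/
structure IsNormalHopfOre (χ : A →ₐ[k] k) (r₁ r₂ x y : A) (δ : A →ₗ[k] A)
    (i : A →ₐc[k] H) (z : H) : Prop where
  extension : ∃ τ : A →ₐ[k] A, τ.toLinearMap = twist χ r₁ ∧ IsGeneralizedHopfOre τ δ r₁ r₂ x y i z
  groupLike₁ : IsGroupLikeElem k r₁
  groupLike₂ : IsGroupLikeElem k r₂
  primitive_x : IsSkewPrimitive k 1 r₂ x
  primitive_y : IsSkewPrimitive k r₁ 1 y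
  zero_iff : x = 0 ↔ y = 0

/-- Isomorphism of generalized Hopf-Ore extensions `A ⊆ H` and `A' ⊆ H'`: an isomorphism of Hopf
algebras `H → H'` that takes `A` onto `A'`. -/
def ExtensionIso {A' : Type*} [Ring A'] [HopfAlgebra k A'] {H' : Type*} [Ring H']
    [HopfAlgebra k H'] (i : A →ₐc[k] H) (i' : A' →ₐc[k] H') : Prop :=
  ∃ Ψ : H ≃ₐc[k] H', Ψ '' Set.range i = Set.range i'

end Extensions

/-! ## The four families -/

section Families

variable {k : Type u} [Field k] {L : Type v} [LieRing L] [LieAlgebra k L]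

/-- The commutator `s t - t s`. -/
def opComm {R : Type*} [Ring R] (s t : R) : R := s * t - t * s

/-- The span of all `v ^ (p ^ r)` with `v ∈ L`, `r ≥ 0`, inside `U(L)`. -/
def hatL (p : ℕ) (k : Type u) [Field k] (L : Type v) [LieRing L] [LieAlgebra k L] :
    Submodule k (UniversalEnvelopingAlgebra k L) :=
  Submodule.span k {t | ∃ (v : L) (r : ℕ), t = UniversalEnvelopingAlgebra.ι k v ^ p ^ r}

/-- `∑ αᵢ a ^ (p ^ i) + ∑ α'ᵢ b ^ (p ^ i)` in `U(L)`, for `a`, `b` in `L`. -/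
def pSum (p : ℕ) (a b : L) (α α' : ℕ →₀ k) : UniversalEnvelopingAlgebra k L :=
  (α.sum fun n c => c • UniversalEnvelopingAlgebra.ι k a ^ p ^ n) +
    α'.sum fun n c => c • UniversalEnvelopingAlgebra.ι k b ^ p ^ n

/-- `-∑ α'ᵢ`. -/
def negSum (α' : ℕ →₀ k) : k := -α'.sum fun _ c => c

/-- The basis `a = e 0`, `b = e 1` satisfies `[a, b] = 0` or `[a, b] = a`. -/
def IsNormalBasis (e : Module.Basis (Fin 2) k L) : Prop :=
  ⁅e 0, e 1⁆ = 0 ∨ ⁅e 0, e 1⁆ = e 0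

variable (p : ℕ) (e : Module.Basis (Fin 2) k L)
  (χ : UniversalEnvelopingAlgebra k L →ₐ[k] k) (x y : UniversalEnvelopingAlgebra k L)
  (δ : UniversalEnvelopingAlgebra k L →ₗ[k] UniversalEnvelopingAlgebra k L)

/-- Family (a). -/
def FamilyA : Prop :=
  let a := UniversalEnvelopingAlgebra.ι k (e 0)
  let b := UniversalEnvelopingAlgebra.ι k (e 1)
  IsNormalBasis e ∧ x = 0 ∧ y = 0 ∧
  (∀ v : L, δ (UniversalEnvelopingAlgebra.ι k v) ∈ hatL p k L) ∧
  δ (UniversalEnvelopingAlgebra.ι k ⁅e 0, e 1⁆) =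
    opComm (δ a) b + opComm a (δ b) + χ a • δ b - χ b • δ a

/-- Family (b). The character is the trivial one: it vanishes on `L`. -/
def FamilyB : Prop :=
  ⁅e 0, e 1⁆ = 0 ∧
  (∀ v : L, χ (UniversalEnvelopingAlgebra.ι k v) = 0) ∧
  x ∈ hatL p k L ∧ y ∈ hatL p k L ∧ x ≠ 0 ∧ y ≠ 0 ∧ Submodule.span k {x} ≠ Submodule.span k {y} ∧
  ∀ v : L, δ (UniversalEnvelopingAlgebra.ι k v) ∈ hatL p k L

/-- Family (c). -/
def FamilyC : Prop :=
  let a := UniversalEnvelopingAlgebra.ι k (e 0)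
  let b := UniversalEnvelopingAlgebra.ι k (e 1)
  ⁅e 0, e 1⁆ = e 0 ∧
  (∀ v : L, χ (UniversalEnvelopingAlgebra.ι k v) = 0) ∧
  x ≠ 0 ∧ y ≠ 0 ∧ Submodule.span k {x} ≠ Submodule.span k {y} ∧
  (∃ α α' β β' : ℕ →₀ k, x = pSum p (e 0) (e 1) α α' ∧ y = pSum p (e 0) (e 1) β β' ∧
    α 0 = 0 ∧ β 0 = 0 ∧ negSum α' = 0 ∧ negSum β' = 0) ∧
  (∀ v : L, δ (UniversalEnvelopingAlgebra.ι k v) ∈ hatL p k L) ∧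
  δ a = opComm (δ a) b + opComm a (δ b)

/-- Family (d), with its three cases (i), (ii), (iii). -/
def FamilyD : Prop :=
  let a := UniversalEnvelopingAlgebra.ι k (e 0)
  let b := UniversalEnvelopingAlgebra.ι k (e 1)
  ⁅e 0, e 1⁆ = e 0 ∧ χ a = 0 ∧ χ b = 1 ∧
  x ≠ 0 ∧ y ≠ 0 ∧ Submodule.span k {x} ≠ Submodule.span k {y} ∧
  (2 : k) • δ a = opComm (δ a) b + opComm a (δ b) ∧
  ∃ α α' β β' : ℕ →₀ k, x = pSum p (e 0) (e 1) α α' ∧ y = pSum p (e 0) (e 1) β β' ∧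
    ((x = α 0 • a ∧
        δ a - (2⁻¹ * α 0 * negSum β') • a ^ 2 ∈ hatL p k L ∧
        δ b - (2⁻¹ * α 0 * β 0) • a ^ 2 ∈ hatL p k L) ∨
      (y = β 0 • a ∧
        δ a - (2⁻¹ * negSum α' * β 0) • a ^ 2 ∈ hatL p k L ∧
        δ b - (2⁻¹ * α 0 * β 0) • a ^ 2 ∈ hatL p k L) ∨
      (negSum α' = 0 ∧
        (∃ c : k, c ≠ 0 ∧ y - β 0 • a = c • (x - α 0 • a) ∧ y - β 0 • a ≠ 0) ∧
        δ a ∈ hatL p k L ∧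
        δ b + (2⁻¹ : k) • (x * y - β 0 • (x * a) - α 0 • (a * y)) ∈ hatL p k L))

/-- The data `χ`, `x`, `y`, `δ` belong to one of the four families, relative to the basis `e`. -/
def InList : Prop :=
  FamilyA p e χ x y δ ∨ FamilyB p e χ x y δ ∨ FamilyC p e χ x y δ ∨ FamilyD p e χ x y δ

end Families

end

end HopfOre

open HopfOre

/-!
In `Δz = z ⊗ r₁ + x ⊗ y + r₂ ⊗ z`, comparison of the coefficients of powers of `z` in
coassociativity shows that `r₁` and `r₂` are group-like and that `x ⊗ y` is a cobar 2-cocycle.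
The coordinates dual to the Poincaré-Birkhoff-Witt basis `bʲaⁱ` multiply like divided powers;
hence `1` is the only group-like element of `U(L)`, its primitive elements are the
`p`-polynomials in `a` and `b`, and either `x` and `y` are primitive or `x ⊗ y` is a multiple of
`1 ⊗ 1`.

The relation `zs = τ(s)z + δ(s)` gives `τ(s) = s + χ(s)` for primitive `s`, and it shows that
`δ(s)` fails to be primitive by the tensor `[x, s] ⊗ y + x ⊗ [y, s] - χ(s) x ⊗ y`. Since `U(L)`
is cocommutative, this tensor is symmetric. A symmetric `x ⊗ y` is the coboundary of `½xy` and
is removed by a shift of `z`. Otherwise `x` and `y` are linearly independent, and symmetry for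
`s = a`, `b` leaves the trivial character, or `[a, b] = a` and `χ(b) = 1`; in the latter case a
shift of `z` makes `y` equal to `a`.

If `x = y = 0` and `δ(L) ⊆ L`, then `L + kz` is a Lie algebra of primitive elements that
generates the extension. Conversely, if `M = N ⊕ km`, then the module `U(N)[z]` of the would-be
Ore extension is a representation of `U(M)`, in which `m` acts as `z`; this makes the powers of
`m` a basis of `U(M)` over `U(N)`.
-/

namespace HopfOre

noncomputable section

open UniversalEnvelopingAlgebra (ι)

attribute [local instance 100] LieRing.ofAssociativeRing

local notation "𝒰" => UniversalEnvelopingAlgebra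

section Enveloping

variable {k : Type u} [Field k] {L : Type v} [LieRing L] [LieAlgebra k L]

theorem ι_lie (v w : L) : ι k ⁅v, w⁆ = ι k v * ι k w - ι k w * ι k v := by
  rw [LieHom.map_lie, LieRing.of_associative_ring_bracket]

theorem mem_of_ι_mul_mem (S : Submodule k (𝒰 k L)) (h1 : 1 ∈ S)
    (hS : ∀ v : L, ∀ s ∈ S, ι k v * s ∈ S) (t : 𝒰 k L) : t ∈ S := by
  let T : Subalgebra k (𝒰 k L) :=
    { carrier := {t | ∀ s ∈ S, t * s ∈ S}
      mul_mem' := fun ht ht' s hs => by rw [mul_assoc]; exact ht _ (ht' _ hs)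
      add_mem' := fun ht ht' s hs => by rw [add_mul]; exact S.add_mem (ht _ hs) (ht' _ hs)
      algebraMap_mem' := fun c s hs => by rw [← Algebra.smul_def]; exact S.smul_mem c hs }
  have ht : t ∈ T := mem_of_ι_mem k T hS t
  simpa only [mul_one] using ht 1 h1

theorem lie_eq_smul_lie (e : Module.Basis (Fin 2) k L) (v w : L) :
    ⁅v, w⁆ = (e.repr v 0 * e.repr w 1 - e.repr v 1 * e.repr w 0) • ⁅e 0, e 1⁆ := by
  conv_lhs => rw [← e.sum_repr v, ← e.sum_repr w]
  simp only [Fin.sum_univ_two, add_lie, lie_add, smul_lie, lie_smul, lie_self, smul_zero, zero_add,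
    add_zero]
  rw [← lie_skew (e 0) (e 1)]
  module

theorem ι_eq_smul_add_smul (e : Module.Basis (Fin 2) k L) (v : L) :
    ι k v = e.repr v 0 • ι k (e 0) + e.repr v 1 • ι k (e 1) := by
  conv_lhs => rw [← e.sum_repr v, Fin.sum_univ_two, map_add, map_smul, map_smul]

theorem comul_ι (v : L) : Coalgebra.comul (R := k) (ι k v) = ι k v ⊗ₜ[k] 1 + 1 ⊗ₜ[k] ι k v :=
  envComul_ι k v

theorem comm_comul (u : 𝒰 k L) :
    TensorProduct.comm k _ _ (Coalgebra.comul (R := k) u) = Coalgebra.comul (R := k) u := by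
  have h : (Algebra.TensorProduct.comm k _ _).toAlgHom.comp (envComul k L) = envComul k L :=
    env_hom_ext k fun v => by
      change Algebra.TensorProduct.comm k _ _ (envComul k L (ι k v)) = _
      rw [envComul_ι, map_add, Algebra.TensorProduct.comm_tmul, Algebra.TensorProduct.comm_tmul,
        add_comm]
  exact DFunLike.congr_fun h u

end Enveloping

section PBW

open Polynomial
open Finset.HasAntidiagonal (antidiagonal)

variable {k : Type u} [Field k] {L : Type v} [LieRing L] [LieAlgebra k L]
  (e : Module.Basis (Fin 2) k L) {ε : k} (he : ⁅e 0, e 1⁆ = ε • e 0)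

section Lift

variable {R : Type*} [Ring R] [Algebra k R] (A B : R) (h : A * B - B * A = ε • A)

/-- The homomorphism from `U(L)` that takes a basis `a`, `b` of `L` with `[a, b] = εa` to elements
`A`, `B` that satisfy the same relation. -/
def liftOfBasis : 𝒰 k L →ₐ[k] R :=
  UniversalEnvelopingAlgebra.lift k
    { e.constr k ![A, B] with
      map_lie' := fun {v w} => by
        change e.constr k ![A, B] ⁅v, w⁆ = ⁅e.constr k ![A, B] v, e.constr k ![A, B] w⁆
        rw [lie_eq_smul_lie e, he, map_smul, map_smul, e.constr_basis,
          Module.Basis.constr_apply_fintype, Module.Basis.constr_apply_fintype,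
          LieRing.of_associative_ring_bracket]
        simp only [Fin.sum_univ_two, Module.Basis.equivFun_apply, Matrix.cons_val_zero,
          Matrix.cons_val_one, ← h, add_mul, mul_add, smul_mul_assoc, mul_smul_comm]
        module }

theorem liftOfBasis_zero : liftOfBasis e he A B h (ι k (e 0)) = A :=
  (UniversalEnvelopingAlgebra.lift_ι_apply k _ _).trans (e.constr_basis k ![A, B] 0)

theorem liftOfBasis_one : liftOfBasis e he A B h (ι k (e 1)) = B :=
  (UniversalEnvelopingAlgebra.lift_ι_apply k _ _).trans (e.constr_basis k ![A, B] 1)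

end Lift

/-- The action of `b` on `k[t][s]`: multiplication by `t`. -/
def pbwB (k : Type u) [Field k] : Module.End k k[X][X] := LinearMap.mulLeft k (C X)

/-- The action of `a` on `k[t][s]` when `[a, b] = εa`: `F(t, s) ↦ s F(t + ε, s)`. -/
def pbwA (ε : k) : Module.End k k[X][X] :=
  LinearMap.mulLeft k X ∘ₗ (mapAlgHom (aeval (X + C ε : k[X]) : k[X] →ₐ[k] k[X])).toLinearMap

theorem pbwA_mul_pbwB_sub (ε : k) : pbwA ε * pbwB k - pbwB k * pbwA ε = ε • pbwA ε := by
  ext1 F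
  rw [LinearMap.smul_apply, Algebra.smul_def]
  simp only [pbwA, pbwB, Module.End.mul_apply, LinearMap.sub_apply, LinearMap.comp_apply,
    LinearMap.mulLeft_apply, AlgHom.toLinearMap_apply, coe_mapAlgHom, Polynomial.map_mul, map_C,
    RingHom.coe_coe, aeval_X, C_add, Polynomial.algebraMap_apply, Algebra.algebraMap_self_apply]
  ring

theorem pbwA_pow_one (ε : k) (i : ℕ) : (pbwA ε ^ i) 1 = X ^ i := by
  induction i with
  | zero => simp
  | succ i ih => rw [pow_succ', Module.End.mul_apply, ih]; simp [pbwA, pow_succ']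

theorem pbwB_pow (j : ℕ) : pbwB k ^ j = LinearMap.mulLeft k (C (X ^ j)) := by
  rw [pbwB, LinearMap.pow_mulLeft, C_pow]

/-- The monomial `bʲ aⁱ`. -/
def pbwMonomial (n : ℕ × ℕ) : 𝒰 k L := ι k (e 1) ^ n.1 * ι k (e 0) ^ n.2

include he in
theorem linearIndependent_pbwMonomial : LinearIndependent k (pbwMonomial (k := k) e) := by
  let φ := liftOfBasis e he (pbwA ε) (pbwB k) (pbwA_mul_pbwB_sub ε)
  refine LinearIndependent.of_comp (LinearMap.applyₗ (1 : k[X][X]) ∘ₗ φ.toLinearMap) ?_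
  convert ((basisMonomials k).smulTower (basisMonomials k[X])).linearIndependent using 1
  funext n
  simp [Module.Basis.smulTower_apply, pbwMonomial, φ, -UniversalEnvelopingAlgebra.ι_apply,
    liftOfBasis_zero, liftOfBasis_one, Module.End.mul_apply, pbwA_pow_one, pbwB_pow,
    X_pow_eq_monomial, smul_monomial, C_mul_monomial]

include he in
theorem ι_zero_mul_ι_one :
    ι k (e 0) * ι k (e 1) = (ι k (e 1) + algebraMap k _ ε) * ι k (e 0) := by
  have h := ι_lie (k := k) (e 0) (e 1)
  rw [he, map_smul, eq_sub_iff_add_eq] at h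
  rw [← h, add_mul, ← Algebra.smul_def, add_comm]

include he in
theorem ι_zero_mul_ι_one_pow (j : ℕ) :
    ι k (e 0) * ι k (e 1) ^ j = (ι k (e 1) + algebraMap k _ ε) ^ j * ι k (e 0) :=
  SemiconjBy.pow_right (ι_zero_mul_ι_one e he) j

theorem aeval_mul_pow_mem_span_pbwMonomial (f : k[X]) (i : ℕ) :
    aeval (ι k (e 1)) f * ι k (e 0) ^ i ∈
      Submodule.span k (Set.range (pbwMonomial (k := k) e)) := by
  rw [aeval_eq_sum_range, Finset.sum_mul]
  refine Submodule.sum_mem _ fun j _ => ?_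
  rw [smul_mul_assoc]
  exact Submodule.smul_mem _ _ (Submodule.subset_span ⟨(j, i), rfl⟩)

include he in
theorem span_pbwMonomial : ⊤ ≤ Submodule.span k (Set.range (pbwMonomial (k := k) e)) := by
  have hone : 1 ∈ Set.range (pbwMonomial (k := k) e) := ⟨(0, 0), by simp [pbwMonomial]⟩
  refine fun t _ => mem_of_ι_mul_mem _ (Submodule.subset_span hone) (fun v s hs => ?_) t
  induction hs using Submodule.span_induction with
  | zero => rw [mul_zero]; exact Submodule.zero_mem _
  | add s s' _ _ h h' => rw [mul_add]; exact Submodule.add_mem _ h h'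
  | smul c s _ h => rw [mul_smul_comm]; exact Submodule.smul_mem _ _ h
  | mem s hs =>
    obtain ⟨⟨j, i⟩, rfl⟩ := hs
    rw [ι_eq_smul_add_smul e, add_mul, smul_mul_assoc, smul_mul_assoc]
    refine Submodule.add_mem _ (Submodule.smul_mem _ _ ?_) (Submodule.smul_mem _ _ ?_)
    · have h := aeval_mul_pow_mem_span_pbwMonomial e ((X + C ε) ^ j) (i + 1)
      rwa [map_pow, map_add, aeval_X, aeval_C, pow_succ', ← mul_assoc,
        ← ι_zero_mul_ι_one_pow e he, mul_assoc] at h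
    · refine Submodule.subset_span ⟨(j + 1, i), ?_⟩
      simp only [pbwMonomial, pow_succ', mul_assoc]

/-- The Poincaré-Birkhoff-Witt basis `bʲ aⁱ` of `U(L)`, for a basis `a`, `b` of `L` with
`[a, b] = εa`. -/
def pbwBasis : Module.Basis (ℕ × ℕ) k (𝒰 k L) :=
  Module.Basis.mk (linearIndependent_pbwMonomial e he) (span_pbwMonomial e he)

theorem pbwBasis_apply (n : ℕ × ℕ) :
    pbwBasis e he n = ι k (e 1) ^ n.1 * ι k (e 0) ^ n.2 := by
  rw [pbwBasis, Module.Basis.mk_apply, pbwMonomial]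

theorem ι_zero_pow (n : ℕ) : ι k (e 0) ^ n = pbwBasis e he (0, n) := by
  rw [pbwBasis_apply, pow_zero, one_mul]

theorem ι_one_pow (n : ℕ) : ι k (e 1) ^ n = pbwBasis e he (n, 0) := by
  rw [pbwBasis_apply, pow_zero, mul_one]

theorem repr_one : (pbwBasis e he).repr 1 = Finsupp.single 0 1 := by
  rw [← pow_zero (ι k (e 0)), ι_zero_pow e he, Module.Basis.repr_self, Prod.zero_eq_mk]

theorem comul_ι_pow (v : L) (j : ℕ) : Coalgebra.comul (R := k) (ι k v ^ j) =
    ∑ s ∈ antidiagonal j, (j.choose s.1 : k) • (ι k v ^ s.1) ⊗ₜ[k] (ι k v ^ s.2) := by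
  have hcomm : Commute (ι k v ⊗ₜ[k] (1 : 𝒰 k L)) ((1 : 𝒰 k L) ⊗ₜ[k] ι k v) := by
    simp [Commute, SemiconjBy]
  rw [Bialgebra.comul_pow, comul_ι, hcomm.add_pow']
  simp only [Algebra.TensorProduct.tmul_pow, Algebra.TensorProduct.tmul_mul_tmul, one_pow, one_mul,
    mul_one, Nat.cast_smul_eq_nsmul]

theorem comul_pbwBasis (n : ℕ × ℕ) : Coalgebra.comul (R := k) (pbwBasis e he n) =
    ∑ s ∈ antidiagonal n.1, ∑ t ∈ antidiagonal n.2, (n.1.choose s.1 * n.2.choose t.1 : k) •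
      pbwBasis e he (s.1, t.1) ⊗ₜ[k] pbwBasis e he (s.2, t.2) := by
  simp only [pbwBasis_apply, Bialgebra.comul_mul, comul_ι_pow, Finset.sum_mul_sum,
    smul_mul_smul_comm, Algebra.TensorProduct.tmul_mul_tmul]

/-- Dually, the coordinates of the PBW basis multiply like divided powers. -/
theorem coord_tmul_coord_comul (m n : ℕ × ℕ) (u : 𝒰 k L) :
    LinearMap.mul' k k (TensorProduct.map ((pbwBasis e he).coord m) ((pbwBasis e he).coord n)
      (Coalgebra.comul (R := k) u)) =
      ((m.1 + n.1).choose m.1 * (m.2 + n.2).choose m.2 : k) *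
        (pbwBasis e he).coord (m + n) u := by
  suffices h : LinearMap.mul' k k ∘ₗ TensorProduct.map ((pbwBasis e he).coord m)
      ((pbwBasis e he).coord n) ∘ₗ Coalgebra.comul (R := k) =
      ((m.1 + n.1).choose m.1 * (m.2 + n.2).choose m.2 : k) • (pbwBasis e he).coord (m + n) from
    LinearMap.congr_fun h u
  refine (pbwBasis e he).ext fun l => ?_
  have hpair (s t : ℕ × ℕ) (c : k) :
      c * ((if (s.1, t.1) = m then 1 else 0) * if (s.2, t.2) = n then 1 else 0) =
        if s = (m.1, n.1) then if t = (m.2, n.2) then c else 0 else 0 := by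
    simp only [Prod.ext_iff, ← ite_and, mul_ite, mul_one, mul_zero]
    exact if_congr (by tauto) rfl rfl
  simp only [LinearMap.comp_apply, comul_pbwBasis, map_sum, map_smul, TensorProduct.map_tmul,
    LinearMap.mul'_apply, Module.Basis.coord_apply, Module.Basis.repr_self, LinearMap.smul_apply,
    Finsupp.single_apply, smul_eq_mul, hpair, Finset.sum_ite_eq', Finset.sum_ite_irrel,
    Finset.sum_const_zero, Finset.HasAntidiagonal.mem_antidiagonal]
  rw [← ite_and]
  by_cases hl : l = m + n
  · simp [hl]
  · rw [if_neg hl, if_neg fun h => hl (Prod.ext h.1.symm h.2.symm), mul_zero]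

end PBW

section SkewPrimitive

variable {k : Type u} [Field k] {A : Type v} [Ring A] [HopfAlgebra k A]

theorem isSkewPrimitive_zero (g h : A) : IsSkewPrimitive k g h 0 := by
  simp [IsSkewPrimitive]

theorem IsSkewPrimitive.add {g h x y : A} (hx : IsSkewPrimitive k g h x)
    (hy : IsSkewPrimitive k g h y) : IsSkewPrimitive k g h (x + y) := by
  rw [IsSkewPrimitive, map_add, hx, hy, TensorProduct.add_tmul, TensorProduct.tmul_add]
  abel

theorem IsSkewPrimitive.smul {g h x : A} (hx : IsSkewPrimitive k g h x) (c : k) :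
    IsSkewPrimitive k g h (c • x) := by
  rw [IsSkewPrimitive, map_smul, hx, smul_add, TensorProduct.smul_tmul', TensorProduct.tmul_smul]

theorem IsSkewPrimitive.sub {g h x y : A} (hx : IsSkewPrimitive k g h x)
    (hy : IsSkewPrimitive k g h y) : IsSkewPrimitive k g h (x - y) := by
  rw [sub_eq_add_neg, ← neg_one_smul k y]
  exact hx.add (hy.smul _)

theorem IsSkewPrimitive.comul_mul {x y : A} (hx : IsSkewPrimitive k 1 1 x)
    (hy : IsSkewPrimitive k 1 1 y) : Coalgebra.comul (R := k) (x * y) =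
      (x * y) ⊗ₜ[k] 1 + 1 ⊗ₜ[k] (x * y) + (x ⊗ₜ[k] y + y ⊗ₜ[k] x) := by
  rw [Bialgebra.comul_mul, hx, hy]
  simp only [add_mul, mul_add, Algebra.TensorProduct.tmul_mul_tmul, one_mul, mul_one]
  abel

theorem IsSkewPrimitive.counit_eq_zero {x : A} (hx : IsSkewPrimitive k 1 1 x) :
    Coalgebra.counit (R := k) x = 0 := by
  have h := Coalgebra.rTensor_counit_comul (R := k) x
  rw [hx, map_add, LinearMap.rTensor_tmul, LinearMap.rTensor_tmul, Bialgebra.counit_one,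
    add_eq_right] at h
  have hx1 : Coalgebra.counit (R := k) x • (1 : A) = 0 := by
    simpa only [TensorProduct.lid_tmul, map_zero] using congrArg (TensorProduct.lid k A) h
  simpa only [map_smul, Bialgebra.counit_one, smul_eq_mul, mul_one, map_zero] using
    congrArg (Coalgebra.counit (R := k)) hx1

theorem isGroupLikeElem_of_ne_zero {r : A} (hr : r ≠ 0)
    (h : Coalgebra.comul (R := k) r = r ⊗ₜ[k] r) : IsGroupLikeElem k r := by
  refine ⟨?_, h⟩
  have hcounit := Coalgebra.rTensor_counit_comul (R := k) r
  rw [h, LinearMap.rTensor_tmul] at hcounit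
  have hr' : Coalgebra.counit (R := k) r • r = (1 : k) • r := by
    simpa using congrArg (TensorProduct.lid k A) hcounit
  exact smul_left_injective k hr hr'

end SkewPrimitive

theorem choose_prime_pow_mul_modEq {p : ℕ} (hp : p.Prime) (r m : ℕ) :
    (p ^ r * m).choose (p ^ r) ≡ m [MOD p] := by
  have := Fact.mk hp
  induction r with
  | zero => simp [Nat.ModEq.refl]
  | succ r ih =>
    refine Choose.choose_modEq_choose_mod_mul_choose_div_nat.trans ?_
    rw [pow_succ', mul_assoc, Nat.mul_mod_right, Nat.mul_mod_right,
      Nat.mul_div_cancel_left _ hp.pos, Nat.mul_div_cancel_left _ hp.pos, Nat.choose_self, one_mul]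
    exact ih

theorem exists_eq_prime_pow_of_dvd_choose {p j : ℕ} (hp : p.Prime) (hj : j ≠ 0)
    (h : ∀ s t, s ≠ 0 → t ≠ 0 → s + t = j → p ∣ (s + t).choose s) : ∃ r, j = p ^ r := by
  obtain ⟨r, m, hm, rfl⟩ := Nat.exists_eq_pow_mul_and_not_dvd hj p hp.ne_one
  refine ⟨r, by_contra fun hne => hm ?_⟩
  have hpos : p ^ r ≠ 0 := (pow_pos hp.pos r).ne'
  obtain ⟨m, rfl⟩ : ∃ m', m = m' + 1 := Nat.exists_eq_succ_of_ne_zero fun h0 => by simp [h0] at hm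
  have hm0 : m ≠ 0 := fun h0 => hne (by simp [h0])
  have hd := h (p ^ r) (p ^ r * m) hpos (mul_ne_zero hpos hm0) (by ring)
  rw [show p ^ r + p ^ r * m = p ^ r * (m + 1) by ring] at hd
  exact ((choose_prime_pow_mul_modEq hp r (m + 1)).dvd_iff dvd_rfl).1 hd

section PrimitiveElements

variable {k : Type u} [Field k] {L : Type v} [LieRing L] [LieAlgebra k L]
  (e : Module.Basis (Fin 2) k L) {ε : k} (he : ⁅e 0, e 1⁆ = ε • e 0)

theorem isSkewPrimitive_ι (v : L) : IsSkewPrimitive k 1 1 (ι k v) := comul_ι v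

theorem repr_mul_repr_of_groupLike {r : 𝒰 k L} (h : IsGroupLikeElem k r) (m n : ℕ × ℕ) :
    (pbwBasis e he).repr r m * (pbwBasis e he).repr r n =
      ((m.1 + n.1).choose m.1 * (m.2 + n.2).choose m.2 : k) * (pbwBasis e he).repr r (m + n) := by
  simpa only [h.comul_eq_tmul_self, TensorProduct.map_tmul, LinearMap.mul'_apply,
    Module.Basis.coord_apply] using coord_tmul_coord_comul e he m n r

theorem support_repr_subset_of_groupLike {r : 𝒰 k L} (h : IsGroupLikeElem k r) :
    ((pbwBasis e he).repr r).support ⊆ {0} := by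
  rcases ((pbwBasis e he).repr r).support.eq_empty_or_nonempty with h0 | hne
  · simp [h0]
  obtain ⟨n, hn, hmax⟩ := Finset.exists_max_image _ (fun n => n.1 + n.2) hne
  have hn0 : n.1 + n.2 = 0 := by
    by_contra hdeg
    have hnn : (pbwBasis e he).repr r (n + n) = 0 := by
      refine Finsupp.notMem_support_iff.1 fun hmem => ?_
      have := hmax _ hmem
      simp only [Prod.fst_add, Prod.snd_add] at this
      omega
    have hsq := repr_mul_repr_of_groupLike e he h n n
    rw [hnn, mul_zero, mul_self_eq_zero] at hsq
    exact Finsupp.mem_support_iff.1 hn hsq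
  intro m hm
  have := hmax m hm
  exact Finset.mem_singleton.2 (Prod.ext (by simp; omega) (by simp; omega))

include he in
theorem eq_one_of_groupLike {r : 𝒰 k L} (h : IsGroupLikeElem k r) : r = 1 := by
  obtain ⟨c, hc⟩ := Finsupp.support_subset_singleton'.1 (support_repr_subset_of_groupLike e he h)
  have hr : r = c • 1 := by
    rw [← (pbwBasis e he).linearCombination_repr r, hc, Finsupp.linearCombination_single,
      Prod.zero_eq_mk, ← ι_zero_pow, pow_zero]
  have hc1 := h.counit_eq_one
  rw [hr, map_smul, Bialgebra.counit_one, smul_eq_mul, mul_one] at hc1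
  rw [hr, hc1, one_smul]

variable {p : ℕ}

theorem pSum_mem_hatL (a b : L) (α α' : ℕ →₀ k) : pSum p a b α α' ∈ hatL p k L :=
  Submodule.add_mem _
    (Submodule.sum_mem _ fun r _ => Submodule.smul_mem _ _ (Submodule.subset_span ⟨a, r, rfl⟩))
    (Submodule.sum_mem _ fun r _ => Submodule.smul_mem _ _ (Submodule.subset_span ⟨b, r, rfl⟩))

theorem repr_pSum (α α' : ℕ →₀ k) (n : ℕ × ℕ) :
    (pbwBasis e he).repr (pSum p (e 0) (e 1) α α') n =
      (α.sum fun i c => if (0, p ^ i) = n then c else 0) +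
        α'.sum fun i c => if (p ^ i, 0) = n then c else 0 := by
  simp only [pSum, ι_zero_pow e he, ι_one_pow e he, Finsupp.sum, map_add, map_sum, map_smul,
    Module.Basis.repr_self, Finsupp.add_apply, Finsupp.finsetSum_apply,
    Finsupp.smul_apply, Finsupp.single_apply, smul_eq_mul, mul_ite, mul_one, mul_zero]

theorem repr_pSum_zero (hp : p.Prime) (α α' : ℕ →₀ k) (r : ℕ) :
    (pbwBasis e he).repr (pSum p (e 0) (e 1) α α') (0, p ^ r) = α r := by
  simp [repr_pSum, Nat.pow_right_inj hp.two_le, hp.ne_zero]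

theorem repr_pSum_one (hp : p.Prime) (α α' : ℕ →₀ k) (r : ℕ) :
    (pbwBasis e he).repr (pSum p (e 0) (e 1) α α') (p ^ r, 0) = α' r := by
  simp [repr_pSum, Nat.pow_right_inj hp.two_le, hp.ne_zero]

include he in
theorem pSum_injective (hp : p.Prime) {α α' β β' : ℕ →₀ k}
    (h : pSum p (e 0) (e 1) α α' = pSum p (e 0) (e 1) β β') : α = β ∧ α' = β' :=
  ⟨Finsupp.ext fun r => by rw [← repr_pSum_zero e he hp α α', h, repr_pSum_zero e he hp],
    Finsupp.ext fun r => by rw [← repr_pSum_one e he hp α α', h, repr_pSum_one e he hp]⟩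

theorem repr_zero_of_primitive {t : 𝒰 k L} (h : IsSkewPrimitive k 1 1 t) :
    (pbwBasis e he).repr t 0 = 0 := by
  have key := coord_tmul_coord_comul e he 0 0 t
  rw [h, map_add, map_add, TensorProduct.map_tmul, TensorProduct.map_tmul] at key
  simpa [repr_one] using key

theorem choose_mul_repr_of_primitive {t : 𝒰 k L} (h : IsSkewPrimitive k 1 1 t) {m n : ℕ × ℕ}
    (hm : m ≠ 0) (hn : n ≠ 0) :
    ((m.1 + n.1).choose m.1 * (m.2 + n.2).choose m.2 : k) * (pbwBasis e he).repr t (m + n) =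
      0 := by
  rw [← Module.Basis.coord_apply, ← coord_tmul_coord_comul, h]
  simp [repr_one, hm, hn]

theorem eq_prime_pow_of_repr_ne_zero [CharP k p] (hp : p.Prime) {t : 𝒰 k L}
    (h : IsSkewPrimitive k 1 1 t) {n : ℕ × ℕ} (hn : (pbwBasis e he).repr t n ≠ 0) :
    (∃ r, n = (0, p ^ r)) ∨ ∃ r, n = (p ^ r, 0) := by
  obtain ⟨j, i⟩ := n
  rcases Nat.eq_zero_or_pos i with rfl | hi <;> rcases Nat.eq_zero_or_pos j with rfl | hj
  · exact absurd (repr_zero_of_primitive e he h) hn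
  · refine .inr ((exists_eq_prime_pow_of_dvd_choose hp hj.ne' fun s s' hs hs' hj => ?_).imp
      fun r hr => by rw [hr])
    have key := choose_mul_repr_of_primitive e he h (m := (s, 0)) (n := (s', 0)) (by simpa)
      (by simpa)
    rw [Prod.mk_add_mk, hj, add_zero] at key
    simpa [hj, CharP.cast_eq_zero_iff k p] using (mul_eq_zero.1 key).resolve_right hn
  · refine .inl ((exists_eq_prime_pow_of_dvd_choose hp hi.ne' fun s s' hs hs' hi => ?_).imp
      fun r hr => by rw [hr])
    have key := choose_mul_repr_of_primitive e he h (m := (0, s)) (n := (0, s')) (by simpa)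
      (by simpa)
    rw [Prod.mk_add_mk, hi, add_zero] at key
    simpa [hi, CharP.cast_eq_zero_iff k p] using (mul_eq_zero.1 key).resolve_right hn
  · have key := choose_mul_repr_of_primitive e he h (m := (j, 0)) (n := (0, i))
      (by simpa using hj.ne')
      (by simpa using hi.ne')
    simp [hn] at key

include he in
theorem exists_eq_pSum [CharP k p] (hp : p.Prime) {t : 𝒰 k L} (h : IsSkewPrimitive k 1 1 t) :
    ∃ α α' : ℕ →₀ k, t = pSum p (e 0) (e 1) α α' := by
  have hmem : t ∈ Submodule.span k (Set.range fun r => ι k (e 0) ^ p ^ r) ⊔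
      Submodule.span k (Set.range fun r => ι k (e 1) ^ p ^ r) := by
    rw [← (pbwBasis e he).linearCombination_repr t, Finsupp.linearCombination_apply]
    refine Submodule.sum_mem _ fun n hn => Submodule.smul_mem _ _ ?_
    rcases eq_prime_pow_of_repr_ne_zero e he hp h (Finsupp.mem_support_iff.1 hn) with
      ⟨r, rfl⟩ | ⟨r, rfl⟩
    · exact Submodule.mem_sup_left (Submodule.subset_span ⟨r, ι_zero_pow e he _⟩)
    · exact Submodule.mem_sup_right (Submodule.subset_span ⟨r, ι_one_pow e he _⟩)
  obtain ⟨s, hs, s', hs', rfl⟩ := Submodule.mem_sup.1 hmem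
  obtain ⟨α, rfl⟩ := Finsupp.mem_span_range_iff_exists_finsupp.1 hs
  obtain ⟨α', rfl⟩ := Finsupp.mem_span_range_iff_exists_finsupp.1 hs'
  exact ⟨α, α', rfl⟩

include he in
theorem mem_hatL_of_primitive [CharP k p] (hp : p.Prime) {t : 𝒰 k L}
    (h : IsSkewPrimitive k 1 1 t) : t ∈ hatL p k L := by
  obtain ⟨α, α', rfl⟩ := exists_eq_pSum e he hp h
  exact pSum_mem_hatL _ _ _ _

end PrimitiveElements

section Commutators

variable {k : Type u} [Field k] {L : Type v} [LieRing L] [LieAlgebra k L] {p : ℕ}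

theorem opComm_pSum (a b : L) (α α' : ℕ →₀ k) (t : 𝒰 k L) :
    opComm (pSum p a b α α') t = (α.sum fun r c => c • opComm (ι k a ^ p ^ r) t) +
      α'.sum fun r c => c • opComm (ι k b ^ p ^ r) t := by
  simp only [opComm, pSum, Finsupp.sum, add_mul, mul_add, Finset.sum_mul, Finset.mul_sum,
    smul_sub, smul_mul_assoc, mul_smul_comm, Finset.sum_sub_distrib]
  abel

theorem opComm_pow_self {R : Type*} [Ring R] (t : R) (n : ℕ) : opComm (t ^ n) t = 0 := by
  rw [opComm, ← pow_succ, ← pow_succ', sub_self]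

variable (e : Module.Basis (Fin 2) k L) (he : ⁅e 0, e 1⁆ = e 0)

include he

theorem opComm_ι_zero_pow (n : ℕ) :
    opComm (ι k (e 0) ^ n) (ι k (e 1)) = (n : k) • ι k (e 0) ^ n := by
  have hab : ι k (e 0) * ι k (e 1) = ι k (e 1) * ι k (e 0) + ι k (e 0) := by
    rw [← sub_eq_iff_eq_add', ← ι_lie, he]
  rw [opComm, sub_eq_iff_eq_add]
  induction n with
  | zero => simp
  | succ n ih =>
    rw [pow_succ', mul_assoc, ih, mul_add, ← mul_assoc, ← mul_assoc, hab, mul_smul_comm, add_mul,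
      Nat.cast_succ]
    module

variable [CharP k p]

theorem opComm_ι_one_prime_pow (hp : p.Prime) (r : ℕ) :
    opComm (ι k (e 1) ^ p ^ r) (ι k (e 0)) = -ι k (e 0) := by
  have := Fact.mk hp
  have : CharP (𝒰 k L) p :=
    charP_of_injective_algebraMap (Bialgebra.algebraMap_injective (R := k) (𝒰 k L)) p
  rw [opComm, ι_zero_mul_ι_one_pow e (ε := 1) (by rw [he, one_smul]), map_one (algebraMap k _),
    add_pow_char_pow_of_commute _ _ (Commute.one_right _), one_pow, add_mul, one_mul,
    sub_add_cancel_left]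

theorem opComm_pSum_ι_zero (hp : p.Prime) (α α' : ℕ →₀ k) :
    opComm (pSum p (e 0) (e 1) α α') (ι k (e 0)) = negSum α' • ι k (e 0) := by
  simp only [opComm_pSum, opComm_pow_self, opComm_ι_one_prime_pow e he hp, smul_zero,
    Finsupp.sum, Finset.sum_const_zero, zero_add, negSum, neg_smul, Finset.sum_smul, smul_neg,
    Finset.sum_neg_distrib]

theorem opComm_pSum_ι_one (α α' : ℕ →₀ k) :
    opComm (pSum p (e 0) (e 1) α α') (ι k (e 1)) = α 0 • ι k (e 0) := by
  have hpow (r : ℕ) (c : k) : c • opComm (ι k (e 0) ^ p ^ r) (ι k (e 1)) =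
      if r = 0 then c • ι k (e 0) else 0 := by
    rw [opComm_ι_zero_pow e he]
    split_ifs with hr <;> simp [hr]
  simp only [opComm_pSum, opComm_pow_self, hpow, smul_zero, Finsupp.sum, Finset.sum_const_zero,
    add_zero, Finset.sum_ite_eq', Finsupp.mem_support_iff, ite_eq_left_iff, not_not]
  exact fun h => by rw [h, zero_smul]

end Commutators

section Ore

variable {k : Type u} [Field k] {A : Type v} [Ring A] [Algebra k A] {H : Type w} [Ring H]
  [Algebra k H]

/-- The map `(aₙ) ↦ ∑ aₙ zⁿ` that is bijective if `H` is an Ore extension of `A`. -/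
def oreMap (i : A →ₐ[k] H) (z : H) : (ℕ →₀ A) →ₗ[k] H :=
  Finsupp.lsum k fun n => LinearMap.mulRight k (z ^ n) ∘ₗ i.toLinearMap

theorem oreMap_apply (i : A →ₐ[k] H) (z : H) (f : ℕ →₀ A) :
    oreMap i z f = f.sum fun n a => i a * z ^ n := rfl

theorem oreMap_single (i : A →ₐ[k] H) (z : H) (n : ℕ) (a : A) :
    oreMap i z (Finsupp.single n a) = i a * z ^ n := by
  rw [oreMap_apply, Finsupp.sum_single_index (by rw [map_zero, zero_mul])]

theorem mul_oreMap_eq_oreMap_smul (i : A →ₐ[k] H) (z : H) (a : A) (f : ℕ →₀ A) :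
    i a * oreMap i z f = oreMap i z (a • f) := by
  induction f using Finsupp.induction_linear with
  | zero => simp only [smul_zero, map_zero, mul_zero]
  | add f g hf hg => simp only [smul_add, map_add, mul_add, hf, hg]
  | single n b =>
    rw [Finsupp.smul_single, oreMap_single, oreMap_single, smul_eq_mul, map_mul, mul_assoc]

/-- Left multiplication by `z` in the Ore extension `A[z; τ, δ]`, on the coefficients of
`∑ aₙ zⁿ`. -/
def oreOp (τ δ : A →ₗ[k] A) : Module.End k (ℕ →₀ A) :=
  Finsupp.lsum k fun n => Finsupp.lsingle (n + 1) ∘ₗ τ + Finsupp.lsingle n ∘ₗ δ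

section oreOp

variable (τ δ : A →ₗ[k] A)

theorem oreOp_single (n : ℕ) (a : A) : oreOp τ δ (Finsupp.single n a) =
    Finsupp.single (n + 1) (τ a) + Finsupp.single n (δ a) := by
  simp [oreOp]

theorem oreOp_apply_zero (f : ℕ →₀ A) : oreOp τ δ f 0 = δ (f 0) := by
  induction f using Finsupp.induction_linear with
  | zero => simp
  | add f g hf hg => simp only [map_add, Finsupp.add_apply, hf, hg]
  | single n a =>
    rw [oreOp_single]
    cases n <;> simp

theorem oreOp_apply_succ (f : ℕ →₀ A) (n : ℕ) :
    oreOp τ δ f (n + 1) = τ (f n) + δ (f (n + 1)) := by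
  induction f using Finsupp.induction_linear with
  | zero => simp
  | add f g hf hg => simp only [map_add, Finsupp.add_apply, hf, hg]; abel
  | single m a =>
    rw [oreOp_single]
    simp only [Finsupp.add_apply, Finsupp.single_apply, add_left_inj]
    split_ifs <;> simp

variable {τ δ}

theorem mul_oreMap {i : A →ₐ[k] H} {z : H} (h : ∀ a : A, z * i a = i (τ a) * z + i (δ a))
    (f : ℕ →₀ A) : z * oreMap i z f = oreMap i z (oreOp τ δ f) := by
  induction f using Finsupp.induction_linear with
  | zero => simp only [map_zero, mul_zero]
  | add f g hf hg => simp only [map_add, mul_add, hf, hg]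
  | single m a =>
    rw [oreOp_single, map_add, oreMap_single, oreMap_single, oreMap_single, ← mul_assoc, h,
      add_mul, pow_succ', mul_assoc]

theorem mul_mem_range_oreMap {i : A →ₐ[k] H} {z : H}
    (h : ∀ a : A, z * i a = i (τ a) * z + i (δ a)) {t : H}
    (ht : t ∈ LinearMap.range (oreMap i z)) : z * t ∈ LinearMap.range (oreMap i z) := by
  obtain ⟨f, rfl⟩ := ht
  exact ⟨_, (mul_oreMap h f).symm⟩

theorem oreOp_pow_single_one (hτ : τ 1 = 1) (hδ : δ 1 = 0) (n : ℕ) :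
    (oreOp τ δ ^ n) (Finsupp.single 0 1) = Finsupp.single n 1 := by
  induction n with
  | zero => rfl
  | succ n ih =>
    rw [pow_succ', Module.End.mul_apply, ih, oreOp_single, hτ, hδ, Finsupp.single_zero, add_zero]

theorem oreMap_injective_of_action {i : A →ₐ[k] H} {z : H} (hτ : τ 1 = 1) (hδ : δ 1 = 0)
    (Φ : H →ₐ[k] Module.End k (ℕ →₀ A)) (hi : ∀ a f, Φ (i a) f = a • f)
    (hz : Φ z = oreOp τ δ) : Function.Injective (oreMap i z) := by
  refine Function.LeftInverse.injective (g := fun t => Φ t (Finsupp.single 0 1)) fun f => ?_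
  induction f using Finsupp.induction_linear with
  | zero => simp only [map_zero, LinearMap.zero_apply]
  | add f g hf hg => simp only [map_add, LinearMap.add_apply, hf, hg]
  | single n a =>
    change Φ (oreMap i z _) _ = _
    rw [oreMap_single, map_mul, map_pow, hz, Module.End.mul_apply, oreOp_pow_single_one hτ hδ, hi,
      Finsupp.smul_single, smul_eq_mul, mul_one]

end oreOp

theorem algHom_mul_mem_range_oreMap (i : A →ₐ[k] H) (z : H) (a : A) {t : H}
    (ht : t ∈ LinearMap.range (oreMap i z)) : i a * t ∈ LinearMap.range (oreMap i z) := by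
  obtain ⟨f, rfl⟩ := ht
  exact ⟨_, (mul_oreMap_eq_oreMap_smul i z a f).symm⟩

theorem one_mem_range_oreMap (i : A →ₐ[k] H) (z : H) : 1 ∈ LinearMap.range (oreMap i z) :=
  ⟨Finsupp.single 0 1, by rw [oreMap_single, map_one, pow_zero, mul_one]⟩

/-- The `τ`-derivation `s ↦ δ(s) + us - τ(s)u` that belongs to the variable `z + u` of
`A[z; τ, δ]`. -/
def shiftDer (τ : A →ₐ[k] A) (δ : A →ₗ[k] A) (u : A) : A →ₗ[k] A :=
  δ + LinearMap.mulLeft k u - LinearMap.mulRight k u ∘ₗ τ.toLinearMap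

theorem shiftDer_apply (τ : A →ₐ[k] A) (δ : A →ₗ[k] A) (u s : A) :
    shiftDer τ δ u s = δ s + u * s - τ s * u := rfl

namespace IsOreExtension

variable {τ : A →ₐ[k] A} {δ : A →ₗ[k] A} {i : A →ₐ[k] H} {z : H} (h : IsOreExtension τ δ i z)

include h

theorem bijective_of_comp {R : Type*} [Ring R] [Algebra k R] {f : A →ₐ[k] R} {t : R}
    (hf : Function.Surjective (oreMap f t)) {G : R →ₐ[k] H} (hG : G.comp f = i) (ht : G t = z) :
    Function.Bijective G := by
  have key : G ∘ oreMap f t = oreMap i z := by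
    refine funext fun s => ?_
    simp only [Function.comp_apply, oreMap_apply, map_finsuppSum, map_mul, map_pow, ht, ← hG,
      AlgHom.comp_apply]
  have hcomp : Function.Bijective (G ∘ oreMap f t) := key ▸ h.basis
  exact ⟨hcomp.1.of_comp_right hf, hcomp.2.of_comp⟩

theorem mem_of_mul_mem (S : Submodule k H) (h1 : 1 ∈ S) (hi : ∀ a, ∀ s ∈ S, i a * s ∈ S)
    (hz : ∀ s ∈ S, z * s ∈ S) (t : H) : t ∈ S := by
  obtain ⟨f, rfl⟩ := h.basis.2 t
  have hpow (n : ℕ) : z ^ n ∈ S := by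
    induction n with
    | zero => rwa [pow_zero]
    | succ n ih => exact pow_succ' z n ▸ hz _ ih
  exact Submodule.sum_mem _ fun n _ => hi _ _ (hpow n)

/-- The coefficient of `zⁿ` in an element of the Ore extension, written with coefficients on the
left. -/
def coeff (n : ℕ) : H →ₗ[k] A :=
  Finsupp.lapply n ∘ₗ (LinearEquiv.ofBijective (oreMap i z) h.basis).symm.toLinearMap

theorem coeff_oreMap (n : ℕ) (f : ℕ →₀ A) : h.coeff n (oreMap i z f) = f n :=
  DFunLike.congr_fun ((LinearEquiv.ofBijective (oreMap i z) h.basis).symm_apply_apply f) n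

theorem coeff_mul_pow (n m : ℕ) (a : A) :
    h.coeff n (i a * z ^ m) = if m = n then a else 0 := by
  rw [← oreMap_single, coeff_oreMap, Finsupp.single_apply]

theorem coeff_mul_z (n : ℕ) (a : A) : h.coeff n (i a * z) = if 1 = n then a else 0 := by
  simpa only [pow_one] using h.coeff_mul_pow n 1 a

theorem coeff_i (n : ℕ) (a : A) : h.coeff n (i a) = if 0 = n then a else 0 := by
  simpa only [pow_zero, mul_one] using h.coeff_mul_pow n 0 a

theorem coeff_z (n : ℕ) : h.coeff n z = if 1 = n then 1 else 0 := by
  simpa only [map_one, one_mul] using h.coeff_mul_z n 1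

theorem coeff_i_mul (n : ℕ) (a : A) (t : H) : h.coeff n (i a * t) = a * h.coeff n t := by
  obtain ⟨f, rfl : oreMap i z f = t⟩ := h.basis.2 t
  rw [mul_oreMap_eq_oreMap_smul, coeff_oreMap, coeff_oreMap, Finsupp.smul_apply, smul_eq_mul]

theorem coeff_zero_z_mul (t : H) : h.coeff 0 (z * t) = δ (h.coeff 0 t) := by
  obtain ⟨f, rfl : oreMap i z f = t⟩ := h.basis.2 t
  rw [mul_oreMap (τ := τ.toLinearMap) h.relation, coeff_oreMap, coeff_oreMap, oreOp_apply_zero]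

theorem coeff_succ_z_mul (n : ℕ) (t : H) :
    h.coeff (n + 1) (z * t) = τ (h.coeff n t) + δ (h.coeff (n + 1) t) := by
  obtain ⟨f, rfl : oreMap i z f = t⟩ := h.basis.2 t
  rw [mul_oreMap (τ := τ.toLinearMap) h.relation, coeff_oreMap, coeff_oreMap, coeff_oreMap,
    oreOp_apply_succ, AlgHom.toLinearMap_apply]

section Shift

variable (u : A)

theorem coeff_add_pow_of_lt {m n : ℕ} (hmn : m < n) : h.coeff n ((z + i u) ^ m) = 0 := by
  induction m generalizing n with
  | zero => rw [pow_zero, ← map_one i, coeff_i, if_neg hmn.ne]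
  | succ m ih =>
    obtain ⟨n, rfl⟩ := Nat.exists_eq_add_of_lt (Nat.zero_lt_of_lt hmn)
    rw [zero_add] at hmn ⊢
    rw [pow_succ', add_mul, map_add, coeff_i_mul, coeff_succ_z_mul, ih (by omega), ih (by omega),
      map_zero, map_zero, mul_zero, add_zero, add_zero]

theorem coeff_add_pow_self (m : ℕ) : h.coeff m ((z + i u) ^ m) = 1 := by
  induction m with
  | zero => rw [pow_zero, ← map_one i, coeff_i, if_pos rfl]
  | succ m ih =>
    rw [pow_succ', add_mul, map_add, coeff_i_mul, coeff_succ_z_mul, ih,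
      h.coeff_add_pow_of_lt u m.lt_succ_self, map_one, map_zero, mul_zero, add_zero, add_zero]

theorem oreMap_add_injective : Function.Injective (oreMap i (z + i u)) := by
  rw [injective_iff_map_eq_zero]
  intro f hf
  by_contra hne
  obtain ⟨n, hn, hle⟩ := f.support.exists_max_image id (Finsupp.support_nonempty_iff.2 hne)
  have hcoeff : h.coeff n (oreMap i (z + i u) f) = f n := by
    rw [oreMap_apply, Finsupp.sum, map_sum, Finset.sum_eq_single_of_mem n hn fun m hm hmn => ?_]
    · rw [coeff_i_mul, coeff_add_pow_self, mul_one]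
    · have hlt : m < n := lt_of_le_of_ne (hle m hm) hmn
      rw [coeff_i_mul, h.coeff_add_pow_of_lt u hlt, mul_zero]
  rw [hf, map_zero] at hcoeff
  exact Finsupp.mem_support_iff.1 hn hcoeff.symm

theorem shift_relation (a : A) :
    (z + i u) * i a = i (τ a) * (z + i u) + i (shiftDer τ δ u a) := by
  simp only [shiftDer_apply, map_sub, map_add, map_mul, add_mul, mul_add, h.relation a]
  abel

theorem oreMap_add_surjective : Function.Surjective (oreMap i (z + i u)) := by
  refine h.mem_of_mul_mem (LinearMap.range (oreMap i (z + i u))) (one_mem_range_oreMap i _)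
    (fun a _ => algHom_mul_mem_range_oreMap i _ a) fun s hs => ?_
  rw [eq_sub_of_add_eq (add_mul z (i u) s).symm]
  exact Submodule.sub_mem _
    (mul_mem_range_oreMap (τ := τ.toLinearMap) (h.shift_relation u) hs)
    (algHom_mul_mem_range_oreMap i _ u hs)

theorem shift : IsOreExtension τ (shiftDer τ δ u) i (z + i u) where
  derivation a b := by
    simp only [shiftDer_apply, h.derivation, map_mul, mul_add, add_mul, sub_mul, mul_sub,
      mul_assoc]
    abel
  relation := h.shift_relation u
  basis := ⟨h.oreMap_add_injective u, h.oreMap_add_surjective u⟩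

end Shift

end IsOreExtension

end Ore

section TensorProduct

variable {k : Type u} [Field k] {V : Type v} [AddCommGroup V] [Module k V]

theorem tmul_right_injective {x : V} (hx : x ≠ 0) (M : Type w) [AddCommGroup M] [Module k M] :
    Function.Injective fun s : M => x ⊗ₜ[k] s := by
  obtain ⟨f, hf⟩ := Module.Projective.exists_dual_ne_zero k hx
  intro s t h
  have hst := congrArg (fun w => TensorProduct.lid k M (f.rTensor M w)) h
  simp only [LinearMap.rTensor_tmul, TensorProduct.lid_tmul] at hst
  exact smul_right_injective M hf hst

theorem tmul_left_injective {x : V} (hx : x ≠ 0) (M : Type w) [AddCommGroup M] [Module k M] :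
    Function.Injective fun s : M => s ⊗ₜ[k] x := by
  have h := (TensorProduct.comm k V M).injective.comp (tmul_right_injective (k := k) hx M)
  simpa only [Function.comp_def, TensorProduct.comm_tmul] using h

theorem exists_smul_eq_of_tmul_comm {x y : V} (hx : x ≠ 0) (h : x ⊗ₜ[k] y = y ⊗ₜ[k] x) :
    ∃ c : k, y = c • x := by
  obtain ⟨f, hf⟩ := Module.Projective.exists_dual_ne_zero k hx
  have hxy := congrArg (fun w => TensorProduct.lid k V (f.rTensor V w)) h
  simp only [LinearMap.rTensor_tmul, TensorProduct.lid_tmul] at hxy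
  exact ⟨(f x)⁻¹ * f y, by rw [mul_smul, ← hxy, inv_smul_smul₀ hf]⟩

end TensorProduct

section TensorCocycle

variable {k : Type u} [Field k] {A : Type v} [Ring A] [HopfAlgebra k A] {x y v : A}

theorem isGroupLikeElem_of_isSkewPrimitive (hx0 : x ≠ 0) (hv0 : v ≠ 0)
    (hx : IsSkewPrimitive k v 1 x) : IsGroupLikeElem k v := by
  refine isGroupLikeElem_of_ne_zero hv0 (tmul_right_injective (k := k) hx0 _ ?_)
  have key := Coalgebra.coassoc_apply (R := k) x
  rw [IsSkewPrimitive] at hx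
  rw [hx] at key
  simp only [map_add, LinearMap.rTensor_tmul, LinearMap.lTensor_tmul, hx,
    TensorProduct.add_tmul, TensorProduct.tmul_add, TensorProduct.assoc_tmul,
    Bialgebra.comul_one, Algebra.TensorProduct.one_def] at key
  rw [add_assoc, add_left_inj] at key
  exact key.symm

theorem eq_counit_smul_of_isSkewPrimitive_zero_one (hx : IsSkewPrimitive k 0 1 x) :
    x = Coalgebra.counit (R := k) x • 1 := by
  have key := congrArg (TensorProduct.rid k A) (Coalgebra.lTensor_counit_comul (R := k) x)
  rw [hx] at key
  simpa using key.symm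

theorem eq_counit_smul_of_isSkewPrimitive_one_zero (hy : IsSkewPrimitive k 1 0 y) :
    y = Coalgebra.counit (R := k) y • 1 := by
  have key := congrArg (TensorProduct.lid k A) (Coalgebra.rTensor_counit_comul (R := k) y)
  rw [hy] at key
  simpa using key.symm

variable (k x y) in
/-- `x ⊗ y` is a 2-cocycle of the cobar complex of `A`; this is what coassociativity imposes on the
middle term of `Δ z = z ⊗ 1 + x ⊗ y + 1 ⊗ z`. -/
def IsTensorCocycle : Prop :=
  TensorProduct.assoc k A A A ((x ⊗ₜ[k] y) ⊗ₜ[k] 1 + Coalgebra.comul (R := k) x ⊗ₜ[k] y) =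
    x ⊗ₜ[k] Coalgebra.comul (R := k) y + 1 ⊗ₜ[k] (x ⊗ₜ[k] y)

namespace IsTensorCocycle

variable (h : IsTensorCocycle k x y)

include h

theorem exists_isSkewPrimitive (hy : y ≠ 0) : ∃ v, IsSkewPrimitive k v 1 x := by
  obtain ⟨f, hf⟩ := Module.Projective.exists_dual_ne_zero k hy
  let F : A ⊗[k] A →ₗ[k] A := (TensorProduct.rid k A).toLinearMap ∘ₗ f.lTensor A
  have hF (t : A ⊗[k] A) (b : A) :
      F.lTensor A (TensorProduct.assoc k A A A (t ⊗ₜ[k] b)) = f b • t := by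
    induction t using TensorProduct.induction_on with
    | zero => simp
    | add t t' h h' => simp only [TensorProduct.add_tmul, map_add, h, h', smul_add]
    | tmul s t => simp [F, TensorProduct.tmul_smul]
  have key := congrArg (F.lTensor A) h
  rw [map_add, map_add, map_add, hF, hF, LinearMap.lTensor_tmul, LinearMap.lTensor_tmul,
    show F (x ⊗ₜ y) = f y • x by simp [F], add_comm, ← eq_sub_iff_add_eq, add_sub_right_comm] at key
  refine ⟨(f y)⁻¹ • (F (Coalgebra.comul (R := k) y) - f 1 • y), ?_⟩
  rw [IsSkewPrimitive, ← inv_smul_smul₀ hf (Coalgebra.comul (R := k) x), key]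
  simp only [smul_add, TensorProduct.tmul_smul, TensorProduct.tmul_sub, inv_smul_smul₀ hf]

theorem isSkewPrimitive_right (hx0 : x ≠ 0) (hx : IsSkewPrimitive k v 1 x) :
    IsSkewPrimitive k 1 v y := by
  rw [IsTensorCocycle, hx, TensorProduct.add_tmul, map_add, map_add, ← add_assoc,
    TensorProduct.assoc_tmul, TensorProduct.assoc_tmul, TensorProduct.assoc_tmul, add_left_inj,
    ← TensorProduct.tmul_add] at h
  exact (tmul_right_injective (k := k) hx0 _ h).symm

theorem primitive_or_scalar (hA : ∀ r : A, IsGroupLikeElem k r → r = 1) :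
    (IsSkewPrimitive k 1 1 x ∧ IsSkewPrimitive k 1 1 y) ∨
      ∃ c : k, x ⊗ₜ[k] y = c • (1 : A) ⊗ₜ[k] (1 : A) := by
  by_cases hx0 : x = 0
  · exact .inr ⟨0, by rw [hx0, TensorProduct.zero_tmul, zero_smul]⟩
  by_cases hy0 : y = 0
  · exact .inr ⟨0, by rw [hy0, TensorProduct.tmul_zero, zero_smul]⟩
  obtain ⟨v, hx⟩ := h.exists_isSkewPrimitive hy0
  have hy := h.isSkewPrimitive_right hx0 hx
  by_cases hv0 : v = 0
  · subst hv0
    refine .inr ⟨Coalgebra.counit (R := k) x * Coalgebra.counit (R := k) y, ?_⟩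
    rw [← TensorProduct.smul_tmul_smul, ← eq_counit_smul_of_isSkewPrimitive_zero_one hx,
      ← eq_counit_smul_of_isSkewPrimitive_one_zero hy]
  · obtain rfl := hA v (isGroupLikeElem_of_isSkewPrimitive hx0 hv0 hx)
    exact .inl ⟨hx, hy⟩

end IsTensorCocycle

end TensorCocycle

section Twist

variable {k : Type u} [Field k] {A : Type v} [Ring A] [HopfAlgebra k A]

theorem Ad_one : Ad (k := k) (1 : A) = LinearMap.id := by
  ext a
  simp [Ad, Algebra.TensorProduct.one_def]

theorem twist_one_apply (χ : A →ₐ[k] k) (a : A) :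
    twist χ 1 a = TensorProduct.lid k A (χ.toLinearMap.rTensor A (Coalgebra.comul (R := k) a)) := by
  rw [twist, LinearMap.comp_apply]
  induction Coalgebra.comul (R := k) a using TensorProduct.induction_on with
  | zero => simp only [map_zero]
  | add t t' h h' => simp only [map_add, h, h']
  | tmul s t => simp [Ad_one]

theorem twist_one_of_primitive (χ : A →ₐ[k] k) {s : A} (hs : IsSkewPrimitive k 1 1 s) :
    twist χ 1 s = s + χ s • 1 := by
  rw [twist_one_apply, hs]
  simp [add_comm]

end Twist

section HopfExtension

variable {k : Type u} [Field k] {A : Type v} [Ring A] [HopfAlgebra k A] {H : Type w} [Ring H]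
  [HopfAlgebra k H] {τ : A →ₐ[k] A} {δ : A →ₗ[k] A} {r₁ r₂ x y : A} {i : A →ₐc[k] H} {z : H}

local notation "i⊗i" => TensorProduct.map (AlgHom.toLinearMap (i : A →ₐ[k] H))
  (AlgHom.toLinearMap (i : A →ₐ[k] H))

variable (i) in
theorem comul_map (a : A) :
    Coalgebra.comul (R := k) (i a) = i⊗i (Coalgebra.comul (R := k) a) :=
  (CoalgHomClass.map_comp_comul_apply i a).symm

/-- The character `ε ∘ τ` of a generalized Hopf-Ore extension: since `Δ ∘ τ = (τ ⊗ id) ∘ Δ`, it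
determines `τ`. -/
abbrev character (τ : A →ₐ[k] A) : A →ₐ[k] k := (Bialgebra.counitAlgHom k A).comp τ

/-- The tensor by which `δ(s)` fails to be primitive when `Δz = z ⊗ 1 + x ⊗ y + 1 ⊗ z`, for a
primitive element `s` on which the character takes the value `c`. -/
def primitivityDefect (x y s : A) (c : k) : A ⊗[k] A :=
  opComm x s ⊗ₜ[k] y + x ⊗ₜ[k] opComm y s - c • x ⊗ₜ[k] y

namespace IsGeneralizedHopfOre

section Coassociativity

variable (h : IsGeneralizedHopfOre τ δ r₁ r₂ x y i z)

include h

theorem coeff_zero_comp : h.ore.coeff 0 ∘ₗ (i : A →ₐ[k] H).toLinearMap = LinearMap.id :=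
  LinearMap.ext fun a => (h.ore.coeff_i 0 a).trans (if_pos rfl)

theorem coeff_one_comp : h.ore.coeff 1 ∘ₗ (i : A →ₐ[k] H).toLinearMap = 0 :=
  LinearMap.ext fun a => (h.ore.coeff_i 1 a).trans (if_neg zero_ne_one)

theorem coeff_zero_hom (a : A) : h.ore.coeff 0 (i a) = a :=
  LinearMap.congr_fun h.coeff_zero_comp a

theorem coeff_one_hom (a : A) : h.ore.coeff 1 (i a) = 0 :=
  LinearMap.congr_fun h.coeff_one_comp a

theorem coeff_zero_z : h.ore.coeff 0 z = 0 := by rw [h.ore.coeff_z, if_neg one_ne_zero]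

theorem coeff_one_z : h.ore.coeff 1 z = 1 := by rw [h.ore.coeff_z, if_pos rfl]

theorem map_coeff_zero_zero_hom (a : A) : TensorProduct.map (h.ore.coeff 0) (h.ore.coeff 0)
    (Coalgebra.comul (R := k) (i a)) = Coalgebra.comul (R := k) a := by
  rw [comul_map, ← LinearMap.comp_apply, ← TensorProduct.map_comp, h.coeff_zero_comp,
    TensorProduct.map_id, LinearMap.id_apply]

theorem map_coeff_one_zero_hom (a : A) : TensorProduct.map (h.ore.coeff 1) (h.ore.coeff 0)
    (Coalgebra.comul (R := k) (i a)) = 0 := by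
  rw [comul_map, ← LinearMap.comp_apply, ← TensorProduct.map_comp, h.coeff_one_comp,
    TensorProduct.map_zero_left, LinearMap.zero_apply]

theorem map_coeff_zero_one_hom (a : A) : TensorProduct.map (h.ore.coeff 0) (h.ore.coeff 1)
    (Coalgebra.comul (R := k) (i a)) = 0 := by
  rw [comul_map, ← LinearMap.comp_apply, ← TensorProduct.map_comp, h.coeff_one_comp,
    TensorProduct.map_zero_right, LinearMap.zero_apply]

theorem map_coeff_zero_zero_z : TensorProduct.map (h.ore.coeff 0) (h.ore.coeff 0)
    (Coalgebra.comul (R := k) z) = x ⊗ₜ[k] y := by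
  simp [h.comul_z, h.coeff_zero_hom, h.coeff_zero_z]

theorem map_coeff_one_zero_z : TensorProduct.map (h.ore.coeff 1) (h.ore.coeff 0)
    (Coalgebra.comul (R := k) z) = 1 ⊗ₜ[k] r₁ := by
  simp [h.comul_z, h.coeff_zero_hom, h.coeff_one_hom, h.coeff_zero_z, h.coeff_one_z]

theorem map_coeff_zero_one_z : TensorProduct.map (h.ore.coeff 0) (h.ore.coeff 1)
    (Coalgebra.comul (R := k) z) = r₂ ⊗ₜ[k] 1 := by
  simp [h.comul_z, h.coeff_zero_hom, h.coeff_one_hom, h.coeff_zero_z, h.coeff_one_z]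

theorem coassoc_map (f g l : H →ₗ[k] A) :
    TensorProduct.assoc k A A A
      (TensorProduct.map f g (Coalgebra.comul (R := k) z) ⊗ₜ l (i r₁) +
        TensorProduct.map f g (Coalgebra.comul (R := k) (i x)) ⊗ₜ l (i y) +
        TensorProduct.map f g (Coalgebra.comul (R := k) (i r₂)) ⊗ₜ l z) =
      f z ⊗ₜ TensorProduct.map g l (Coalgebra.comul (R := k) (i r₁)) +
        f (i x) ⊗ₜ TensorProduct.map g l (Coalgebra.comul (R := k) (i y)) +
        f (i r₂) ⊗ₜ TensorProduct.map g l (Coalgebra.comul (R := k) z) := by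
  have key := congrArg (TensorProduct.map f (TensorProduct.map g l))
    (Coalgebra.coassoc_apply (R := k) z)
  rw [show TensorProduct.map f (TensorProduct.map g l) (TensorProduct.assoc k H H H _) = _ from
    LinearMap.congr_fun (TensorProduct.map_map_comp_assoc_eq f g l) _, h.comul_z] at key
  simpa only [map_add, LinearMap.rTensor_tmul, LinearMap.lTensor_tmul, TensorProduct.map_tmul,
    LinearMap.comp_apply, LinearEquiv.coe_coe] using key

theorem r₁_ne_zero : r₁ ≠ 0 := by
  have := Bialgebra.nontrivial (A := A) k
  intro h0
  have key := congrArg (h.ore.coeff 1) (congrArg (TensorProduct.rid k H)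
    (Coalgebra.lTensor_counit_comul (R := k) z))
  simp [h.comul_z, h.coeff_one_z, h.coeff_one_hom, h0] at key

theorem r₂_ne_zero : r₂ ≠ 0 := by
  have := Bialgebra.nontrivial (A := A) k
  intro h0
  have key := congrArg (h.ore.coeff 1) (congrArg (TensorProduct.lid k H)
    (Coalgebra.rTensor_counit_comul (R := k) z))
  simp [h.comul_z, h.coeff_one_z, h.coeff_one_hom, h0] at key

theorem isGroupLikeElem_r₁ : IsGroupLikeElem k r₁ := by
  have := Bialgebra.nontrivial (A := A) k
  refine isGroupLikeElem_of_ne_zero h.r₁_ne_zero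
    (tmul_right_injective (k := k) (one_ne_zero (α := A)) _ ?_)
  have key := h.coassoc_map (h.ore.coeff 1) (h.ore.coeff 0) (h.ore.coeff 0)
  simp only [h.map_coeff_one_zero_z, h.map_coeff_one_zero_hom, h.map_coeff_zero_zero_hom,
    h.coeff_zero_hom, h.coeff_one_hom, h.coeff_zero_z, h.coeff_one_z, TensorProduct.tmul_zero,
    TensorProduct.zero_tmul, add_zero, TensorProduct.assoc_tmul] at key
  exact key.symm

theorem isGroupLikeElem_r₂ : IsGroupLikeElem k r₂ := by
  have := Bialgebra.nontrivial (A := A) k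
  refine isGroupLikeElem_of_ne_zero h.r₂_ne_zero
    (tmul_left_injective (k := k) (one_ne_zero (α := A)) _ ?_)
  have key := h.coassoc_map (h.ore.coeff 0) (h.ore.coeff 0) (h.ore.coeff 1)
  simp only [h.map_coeff_zero_one_z, h.map_coeff_zero_one_hom, h.map_coeff_zero_zero_hom,
    h.coeff_zero_hom, h.coeff_one_hom, h.coeff_zero_z, h.coeff_one_z, TensorProduct.tmul_zero,
    zero_add] at key
  rwa [← TensorProduct.assoc_tmul, EmbeddingLike.apply_eq_iff_eq] at key

end Coassociativity

section Relation

variable (h : IsGeneralizedHopfOre τ δ 1 1 x y i z)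

include h

theorem isTensorCocycle : IsTensorCocycle k x y := by
  have key := h.coassoc_map (h.ore.coeff 0) (h.ore.coeff 0) (h.ore.coeff 0)
  rw [IsTensorCocycle]
  simpa only [h.map_coeff_zero_zero_z, h.map_coeff_zero_zero_hom, h.coeff_zero_hom,
    h.coeff_zero_z, TensorProduct.zero_tmul, TensorProduct.tmul_zero, add_zero, zero_add]
    using key

theorem comul_z' :
    Coalgebra.comul (R := k) z = z ⊗ₜ[k] 1 + i x ⊗ₜ[k] i y + 1 ⊗ₜ[k] z := by
  rw [h.comul_z, map_one]

theorem comul_relation (a : A) :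
    Coalgebra.comul (R := k) z * i⊗i (Coalgebra.comul (R := k) a) =
      i⊗i (Coalgebra.comul (R := k) (τ a)) * Coalgebra.comul (R := k) z +
        Coalgebra.comul (R := k) (i (δ a)) := by
  rw [← comul_map, ← comul_map, ← Bialgebra.comul_mul, ← Bialgebra.comul_mul, ← map_add]
  exact congrArg _ (h.ore.relation a)

theorem coeff_zero_mul_z (a : A) : h.ore.coeff 0 (i a * z) = 0 :=
  (h.ore.coeff_mul_z 0 a).trans (if_neg one_ne_zero)

theorem coeff_one_mul_z (a : A) : h.ore.coeff 1 (i a * z) = a :=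
  (h.ore.coeff_mul_z 1 a).trans (if_pos rfl)

theorem coeff_zero_z_mul_hom (a : A) : h.ore.coeff 0 (z * i a) = δ a := by
  rw [h.ore.coeff_zero_z_mul, h.coeff_zero_hom]

theorem coeff_one_z_mul_hom (a : A) : h.ore.coeff 1 (z * i a) = τ a := by
  rw [h.ore.coeff_succ_z_mul, h.coeff_zero_hom, h.coeff_one_hom, map_zero, add_zero]

theorem map_coeff_one_zero_comul_z_mul (t : A ⊗[k] A) :
    TensorProduct.map (h.ore.coeff 1) (h.ore.coeff 0) (Coalgebra.comul (R := k) z * i⊗i t) =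
      τ.toLinearMap.rTensor A t := by
  induction t using TensorProduct.induction_on with
  | zero => simp only [map_zero, mul_zero]
  | add t t' ht ht' => simp only [mul_add, map_add, ht, ht']
  | tmul s t =>
    simp [h.comul_z', add_mul, h.coeff_one_z_mul_hom, h.coeff_zero_hom, h.coeff_one_hom,
      ← map_mul]

theorem map_coeff_one_zero_mul_comul_z (t : A ⊗[k] A) :
    TensorProduct.map (h.ore.coeff 1) (h.ore.coeff 0) (i⊗i t * Coalgebra.comul (R := k) z) = t := by
  induction t using TensorProduct.induction_on with
  | zero => simp only [map_zero, zero_mul]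
  | add t t' ht ht' => simp only [add_mul, map_add, ht, ht']
  | tmul s t =>
    simp [h.comul_z', mul_add, h.coeff_one_mul_z, h.coeff_zero_hom, h.coeff_one_hom, ← map_mul]

theorem map_coeff_zero_zero_comul_z_mul (t : A ⊗[k] A) :
    TensorProduct.map (h.ore.coeff 0) (h.ore.coeff 0) (Coalgebra.comul (R := k) z * i⊗i t) =
      δ.rTensor A t + x ⊗ₜ[k] y * t + δ.lTensor A t := by
  induction t using TensorProduct.induction_on with
  | zero => simp only [map_zero, mul_zero, add_zero]
  | add t t' ht ht' => simp only [mul_add, map_add, ht, ht']; abel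
  | tmul s t =>
    simp [h.comul_z', add_mul, h.coeff_zero_z_mul_hom, h.coeff_zero_hom, ← map_mul]

theorem map_coeff_zero_zero_mul_comul_z (t : A ⊗[k] A) :
    TensorProduct.map (h.ore.coeff 0) (h.ore.coeff 0) (i⊗i t * Coalgebra.comul (R := k) z) =
      t * x ⊗ₜ[k] y := by
  induction t using TensorProduct.induction_on with
  | zero => simp only [map_zero, zero_mul]
  | add t t' ht ht' => simp only [add_mul, map_add, ht, ht']
  | tmul s t =>
    simp [h.comul_z', mul_add, h.coeff_zero_mul_z, h.coeff_zero_hom, ← map_mul]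

theorem comul_τ (a : A) : Coalgebra.comul (R := k) (τ a) =
    τ.toLinearMap.rTensor A (Coalgebra.comul (R := k) a) := by
  have key := congrArg (TensorProduct.map (h.ore.coeff 1) (h.ore.coeff 0)) (h.comul_relation a)
  rw [map_add, h.map_coeff_one_zero_hom, h.map_coeff_one_zero_comul_z_mul,
    h.map_coeff_one_zero_mul_comul_z, add_zero] at key
  exact key.symm

theorem comul_δ (a : A) :
    δ.rTensor A (Coalgebra.comul (R := k) a) + x ⊗ₜ[k] y * Coalgebra.comul (R := k) a +
      δ.lTensor A (Coalgebra.comul (R := k) a) =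
    Coalgebra.comul (R := k) (τ a) * x ⊗ₜ[k] y + Coalgebra.comul (R := k) (δ a) := by
  have key := congrArg (TensorProduct.map (h.ore.coeff 0) (h.ore.coeff 0)) (h.comul_relation a)
  rwa [map_add, h.map_coeff_zero_zero_hom, h.map_coeff_zero_zero_comul_z_mul,
    h.map_coeff_zero_zero_mul_comul_z] at key

theorem τ_eq_twist : τ.toLinearMap = twist (character τ) 1 := by
  ext a
  have key := congrArg (TensorProduct.lid k A) (Coalgebra.rTensor_counit_comul (R := k) (τ a))
  rw [TensorProduct.lid_tmul, one_smul] at key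
  rw [twist_one_apply, AlgHom.toLinearMap_apply, ← key, h.comul_τ, ← LinearMap.comp_apply,
    ← LinearMap.rTensor_comp]
  rfl

theorem isNormalHopfOre (hx : IsSkewPrimitive k 1 1 x) (hy : IsSkewPrimitive k 1 1 y)
    (hxy : x = 0 ↔ y = 0) : IsNormalHopfOre (character τ) 1 1 x y δ i z :=
  ⟨⟨τ, h.τ_eq_twist, h⟩, .one, .one, hx, hy, hxy⟩

theorem τ_of_primitive {s : A} (hs : IsSkewPrimitive k 1 1 s) : τ s = s + character τ s • 1 :=
  (LinearMap.congr_fun h.τ_eq_twist s).trans (twist_one_of_primitive _ hs)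

theorem comul_δ_of_primitive {s : A} (hs : IsSkewPrimitive k 1 1 s) :
    Coalgebra.comul (R := k) (δ s) = δ s ⊗ₜ[k] 1 + 1 ⊗ₜ[k] δ s +
      primitivityDefect x y s (character τ s) := by
  have hδ1 : δ 1 = 0 := by simpa using h.ore.derivation 1 1
  have key := h.comul_δ s
  rw [h.τ_of_primitive hs, map_add, map_smul, hs] at key
  simp only [map_add, LinearMap.rTensor_tmul, LinearMap.lTensor_tmul, hδ1, mul_add, add_mul,
    TensorProduct.tmul_zero, TensorProduct.zero_tmul, add_zero, zero_add, Bialgebra.comul_one,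
    smul_mul_assoc, one_mul, Algebra.TensorProduct.tmul_mul_tmul, mul_one] at key
  rw [← sub_eq_iff_eq_add'] at key
  rw [← key]
  simp only [primitivityDefect, opComm, TensorProduct.sub_tmul, TensorProduct.tmul_sub]
  abel

theorem isSkewPrimitive_δ {s : A} (hs : IsSkewPrimitive k 1 1 s)
    (h0 : primitivityDefect x y s (character τ s) = 0) : IsSkewPrimitive k 1 1 (δ s) := by
  rw [IsSkewPrimitive, h.comul_δ_of_primitive hs, h0, add_zero]

theorem δ_opComm {s t : A} (hs : IsSkewPrimitive k 1 1 s) (ht : IsSkewPrimitive k 1 1 t) :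
    δ (opComm s t) =
      opComm (δ s) t + opComm s (δ t) + character τ s • δ t - character τ t • δ s := by
  rw [opComm, map_sub, h.ore.derivation, h.ore.derivation, h.τ_of_primitive hs,
    h.τ_of_primitive ht]
  simp only [add_mul, smul_mul_assoc, one_mul, opComm]
  abel

theorem shift {x' y' : A} (u : A) (hu : Coalgebra.comul (R := k) u + x ⊗ₜ[k] y =
      u ⊗ₜ[k] 1 + 1 ⊗ₜ[k] u + x' ⊗ₜ[k] y') :
    IsGeneralizedHopfOre τ (shiftDer τ δ u) 1 1 x' y' i (z + i u) := by
  refine ⟨h.ore.shift u, ?_⟩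
  have key : Coalgebra.comul (R := k) (i u) + i x ⊗ₜ[k] i y =
      i u ⊗ₜ[k] 1 + 1 ⊗ₜ[k] i u + i x' ⊗ₜ[k] i y' := by
    simpa [← comul_map] using congrArg i⊗i hu
  rw [map_add, h.comul_z', map_one i, TensorProduct.add_tmul, TensorProduct.tmul_add,
    ← sub_eq_zero]
  rw [← sub_eq_zero] at key
  rw [← key]
  abel

end Relation

end IsGeneralizedHopfOre

end HopfExtension

section Obstruction

variable {k : Type u} [Field k] {L : Type v} [LieRing L] [LieAlgebra k L] {H : Type w} [Ring H]
  [HopfAlgebra k H] {τ : 𝒰 k L →ₐ[k] 𝒰 k L} {δ : 𝒰 k L →ₗ[k] 𝒰 k L} {x y : 𝒰 k L}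
  {i : 𝒰 k L →ₐc[k] H} {z : H}

theorem opComm_ι (v w : L) : opComm (ι k v) (ι k w) = ι k ⁅v, w⁆ := (ι_lie v w).symm

theorem opComm_ι_eq_zero (hL : ∀ v w : L, ⁅v, w⁆ = 0) (t : 𝒰 k L) (v : L) :
    opComm t (ι k v) = 0 := by
  have hmem := mem_of_ι_mem k (Subalgebra.centralizer k {ι k v}) (fun w => by
    rw [Subalgebra.mem_centralizer_iff]
    rintro _ rfl
    rw [← sub_eq_zero, ← ι_lie, hL, map_zero]) t
  rw [opComm, ← Subalgebra.mem_centralizer_iff k |>.1 hmem _ rfl, sub_self]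

theorem character_ι_lie (τ : 𝒰 k L →ₐ[k] 𝒰 k L) (v w : L) : character τ (ι k ⁅v, w⁆) = 0 := by
  rw [ι_lie, map_sub, map_mul, map_mul, mul_comm, sub_self]

namespace IsGeneralizedHopfOre

variable (h : IsGeneralizedHopfOre τ δ 1 1 x y i z)

include h

theorem δ_ι_lie (v w : L) : δ (ι k ⁅v, w⁆) = opComm (δ (ι k v)) (ι k w) +
    opComm (ι k v) (δ (ι k w)) + character τ (ι k v) • δ (ι k w) -
      character τ (ι k w) • δ (ι k v) := by
  rw [← opComm_ι]
  exact h.δ_opComm (isSkewPrimitive_ι v) (isSkewPrimitive_ι w)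

theorem comm_primitivityDefect (v : L) :
    TensorProduct.comm k _ _ (primitivityDefect x y (ι k v) (character τ (ι k v))) =
      primitivityDefect x y (ι k v) (character τ (ι k v)) := by
  have key := comm_comul (k := k) (δ (ι k v))
  rwa [h.comul_δ_of_primitive (isSkewPrimitive_ι v), map_add, map_add, TensorProduct.comm_tmul,
    TensorProduct.comm_tmul, add_comm (1 ⊗ₜ[k] _), add_right_inj] at key

end IsGeneralizedHopfOre

end Obstruction

section Independence

variable {k : Type u} [Field k] {V : Type v} [AddCommGroup V] [Module k V] {x y : V}

theorem linearIndependent_of_tmul_ne (h : x ⊗ₜ[k] y ≠ y ⊗ₜ[k] x) : LinearIndependent k ![x, y] := by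
  have hx : x ≠ 0 := fun h0 => h (by rw [h0, TensorProduct.zero_tmul, TensorProduct.tmul_zero])
  refine (LinearIndependent.pair_iff' hx).2 fun c hc => h ?_
  rw [← hc, TensorProduct.tmul_smul, TensorProduct.smul_tmul']

theorem eq_zero_of_smul_tmul_comm (h : LinearIndependent k ![x, y]) {c : k}
    (hc : c • x ⊗ₜ[k] y = c • y ⊗ₜ[k] x) : c = 0 := by
  by_contra hne
  obtain ⟨d, hd⟩ := exists_smul_eq_of_tmul_comm (h.ne_zero 0) (smul_right_injective _ hne hc)
  exact (LinearIndependent.pair_iff' (h.ne_zero 0)).1 h d hd.symm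

theorem eq_zero_of_smul_eq_smul (h : LinearIndependent k ![x, y]) {s t : k}
    (hst : s • x = t • y) : s = 0 ∧ t = 0 := by
  obtain ⟨hs, ht⟩ := LinearIndependent.pair_iff.1 h s (-t) (by rw [hst, neg_smul, add_neg_cancel])
  exact ⟨hs, neg_eq_zero.1 ht⟩

theorem span_singleton_ne (h : LinearIndependent k ![x, y]) :
    Submodule.span k {x} ≠ Submodule.span k {y} := by
  intro hspan
  obtain ⟨c, hc⟩ := Submodule.mem_span_singleton.1 (hspan ▸ Submodule.mem_span_singleton_self y)
  exact (LinearIndependent.pair_iff' (h.ne_zero 0)).1 h c hc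

end Independence

section Normalization

variable {k : Type u} [Field k] {A : Type v} [Ring A] [HopfAlgebra k A] {x y a : A}

theorem comul_half_mul (h2 : (2 : k) ≠ 0) (hx : IsSkewPrimitive k 1 1 x)
    (hy : IsSkewPrimitive k 1 1 y) (hxy : x ⊗ₜ[k] y = y ⊗ₜ[k] x) :
    Coalgebra.comul (R := k) ((2⁻¹ : k) • (x * y)) =
      ((2⁻¹ : k) • (x * y)) ⊗ₜ[k] 1 + 1 ⊗ₜ[k] ((2⁻¹ : k) • (x * y)) + x ⊗ₜ[k] y := by
  rw [map_smul, hx.comul_mul hy, ← hxy, ← two_smul k (x ⊗ₜ[k] y), smul_add, inv_smul_smul₀ h2,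
    smul_add, TensorProduct.smul_tmul', TensorProduct.tmul_smul]

/-- The element by which `z` is shifted in order to replace the term `x ⊗ y` of `Δz` by
`(βx - αy) ⊗ a`. -/
def normalizer (α β : k) (a x y : A) : A :=
  (α * β) • (2⁻¹ : k) • (a * a) - α • (a * y) - (2⁻¹ : k) • ((x - α • a) * (y - β • a))

theorem comul_normalizer (h2 : (2 : k) ≠ 0) (hx : IsSkewPrimitive k 1 1 x)
    (hy : IsSkewPrimitive k 1 1 y) (ha : IsSkewPrimitive k 1 1 a) {α β : k}
    (hxy : (x - α • a) ⊗ₜ[k] (y - β • a) = (y - β • a) ⊗ₜ[k] (x - α • a)) :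
    Coalgebra.comul (R := k) (normalizer α β a x y) + x ⊗ₜ[k] y =
      normalizer α β a x y ⊗ₜ[k] 1 + 1 ⊗ₜ[k] normalizer α β a x y +
        (β • x - α • y) ⊗ₜ[k] a := by
  have hXY := comul_half_mul h2 (hx.sub (ha.smul α)) (hy.sub (ha.smul β)) hxy
  have haa := comul_half_mul h2 ha ha rfl
  rw [normalizer, map_sub, map_sub, map_smul _ (α * β), map_smul _ α, hXY, haa, ha.comul_mul hy]
  simp only [TensorProduct.sub_tmul, TensorProduct.tmul_sub, ← TensorProduct.smul_tmul',
    TensorProduct.tmul_smul]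
  module

end Normalization

section Classification

variable {k : Type u} [Field k] {p : ℕ} {L : Type v} [LieRing L] [LieAlgebra k L]
  {H : Type w} [Ring H] [HopfAlgebra k H] {τ : 𝒰 k L →ₐ[k] 𝒰 k L} {δ : 𝒰 k L →ₗ[k] 𝒰 k L}
  {x y : 𝒰 k L} {i : 𝒰 k L →ₐc[k] H} {z : H}

/-- The extension `i` of `U(L)` has a presentation by data in normal form that belong to one of the
four families. -/
def HasNormalForm (p : ℕ) (e : Module.Basis (Fin 2) k L) (i : 𝒰 k L →ₐc[k] H) : Prop :=
  ∃ (χ : 𝒰 k L →ₐ[k] k) (x y : 𝒰 k L) (δ : 𝒰 k L →ₗ[k] 𝒰 k L) (z : H),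
    IsNormalHopfOre χ 1 1 x y δ i z ∧ InList p e χ x y δ

variable {e : Module.Basis (Fin 2) k L}

theorem IsNormalBasis.exists_smul (he : IsNormalBasis e) : ∃ ε : k, ⁅e 0, e 1⁆ = ε • e 0 := by
  rcases he with he | he
  · exact ⟨0, by rw [he, zero_smul]⟩
  · exact ⟨1, by rw [he, one_smul]⟩

/-- The coefficient of `a` in the basis `bʲaⁱ` of `U(L)`. -/
def aCoord (e : Module.Basis (Fin 2) k L) {ε : k} (he : ⁅e 0, e 1⁆ = ε • e 0) : 𝒰 k L →ₗ[k] k :=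
  (pbwBasis e he).coord (0, 1)

theorem aCoord_ι_zero {ε : k} (he : ⁅e 0, e 1⁆ = ε • e 0) : aCoord e he (ι k (e 0)) = 1 := by
  rw [aCoord, ← pow_one (ι k (e 0)), ι_zero_pow e he, Module.Basis.coord_apply,
    Module.Basis.repr_self, Finsupp.single_eq_same]

theorem aCoord_pSum (hp : p.Prime) {ε : k} (he : ⁅e 0, e 1⁆ = ε • e 0) (α α' : ℕ →₀ k) :
    aCoord e he (pSum p (e 0) (e 1) α α') = α 0 := by
  simpa only [pow_zero, aCoord, Module.Basis.coord_apply] using repr_pSum_zero e he hp α α' 0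

theorem pSum_single_zero (p : ℕ) (e : Module.Basis (Fin 2) k L) :
    pSum p (e 0) (e 1) (Finsupp.single 0 1) 0 = ι k (e 0) := by
  simp [pSum, -UniversalEnvelopingAlgebra.ι_apply]

theorem character_ι_zero (he : ⁅e 0, e 1⁆ = e 0) (τ : 𝒰 k L →ₐ[k] 𝒰 k L) :
    character τ (ι k (e 0)) = 0 := by
  simpa only [he] using character_ι_lie τ (e 0) (e 1)

variable [CharP k p]

theorem IsGeneralizedHopfOre.familyA (hp : p.Prime) (he : IsNormalBasis e)
    (h : IsGeneralizedHopfOre τ δ 1 1 0 0 i z) : FamilyA p e (character τ) 0 0 δ := by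
  obtain ⟨ε, he'⟩ := he.exists_smul
  refine ⟨he, rfl, rfl, fun v => mem_hatL_of_primitive e he' hp ?_, h.δ_ι_lie _ _⟩
  exact h.isSkewPrimitive_δ (isSkewPrimitive_ι v) (by simp [primitivityDefect])

theorem IsGeneralizedHopfOre.hasNormalForm_of_comul_eq (hp : p.Prime) (he : IsNormalBasis e)
    (h : IsGeneralizedHopfOre τ δ 1 1 x y i z) {u : 𝒰 k L}
    (hu : Coalgebra.comul (R := k) u = u ⊗ₜ[k] 1 + 1 ⊗ₜ[k] u + x ⊗ₜ[k] y) :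
    HasNormalForm p e i := by
  have hs := h.shift (x' := 0) (y' := 0) (-u) (by
    rw [map_neg, hu, TensorProduct.neg_tmul, TensorProduct.tmul_neg, TensorProduct.tmul_zero]
    abel)
  exact ⟨_, _, _, _, _, hs.isNormalHopfOre (isSkewPrimitive_zero _ _) (isSkewPrimitive_zero _ _)
    Iff.rfl, .inl (hs.familyA hp he)⟩

theorem IsGeneralizedHopfOre.familyB (hp : p.Prime) (he : ⁅e 0, e 1⁆ = 0)
    (h : IsGeneralizedHopfOre τ δ 1 1 x y i z) (hx : IsSkewPrimitive k 1 1 x)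
    (hy : IsSkewPrimitive k 1 1 y) (hxy : LinearIndependent k ![x, y]) :
    FamilyB p e (character τ) x y δ := by
  have he' : ⁅e 0, e 1⁆ = (0 : k) • e 0 := by rw [he, zero_smul]
  have hL (v w : L) : ⁅v, w⁆ = 0 := by rw [lie_eq_smul_lie e, he, smul_zero]
  have hdefect (v : L) : primitivityDefect x y (ι k v) (character τ (ι k v)) =
      -(character τ (ι k v) • x ⊗ₜ[k] y) := by
    rw [primitivityDefect, opComm_ι_eq_zero hL, opComm_ι_eq_zero hL, TensorProduct.zero_tmul,
      TensorProduct.tmul_zero, zero_add, zero_sub]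
  have hχ (v : L) : character τ (ι k v) = 0 := by
    have hcomm := h.comm_primitivityDefect v
    rw [hdefect, map_neg, map_smul, TensorProduct.comm_tmul, neg_inj] at hcomm
    exact eq_zero_of_smul_tmul_comm hxy hcomm.symm
  refine ⟨he, hχ, mem_hatL_of_primitive e he' hp hx, mem_hatL_of_primitive e he' hp hy,
    hxy.ne_zero 0, hxy.ne_zero 1, span_singleton_ne hxy, fun v => mem_hatL_of_primitive e he' hp ?_⟩
  exact h.isSkewPrimitive_δ (isSkewPrimitive_ι v) (by rw [hdefect, hχ, zero_smul, neg_zero])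

section Nonabelian

variable {α α' β β' : ℕ →₀ k} (hp : p.Prime) (he : ⁅e 0, e 1⁆ = e 0)
  (h : IsGeneralizedHopfOre τ δ 1 1 (pSum p (e 0) (e 1) α α') (pSum p (e 0) (e 1) β β') i z)

include he

include hp in
theorem primitivityDefect_ι_zero (τ : 𝒰 k L →ₐ[k] 𝒰 k L) (α α' β β' : ℕ →₀ k) :
    primitivityDefect (pSum p (e 0) (e 1) α α') (pSum p (e 0) (e 1) β β') (ι k (e 0))
        (character τ (ι k (e 0))) =
      negSum α' • ι k (e 0) ⊗ₜ[k] pSum p (e 0) (e 1) β β' +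
        negSum β' • pSum p (e 0) (e 1) α α' ⊗ₜ[k] ι k (e 0) := by
  rw [primitivityDefect, opComm_pSum_ι_zero e he hp, opComm_pSum_ι_zero e he hp,
    character_ι_zero he, zero_smul, sub_zero, TensorProduct.smul_tmul', TensorProduct.tmul_smul]

theorem primitivityDefect_ι_one (c : k) (α α' β β' : ℕ →₀ k) :
    primitivityDefect (pSum p (e 0) (e 1) α α') (pSum p (e 0) (e 1) β β') (ι k (e 1)) c =
      α 0 • ι k (e 0) ⊗ₜ[k] pSum p (e 0) (e 1) β β' +
        β 0 • pSum p (e 0) (e 1) α α' ⊗ₜ[k] ι k (e 0) -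
          c • pSum p (e 0) (e 1) α α' ⊗ₜ[k] pSum p (e 0) (e 1) β β' := by
  simp only [primitivityDefect, opComm_pSum_ι_one e he, ← TensorProduct.smul_tmul',
    TensorProduct.tmul_smul]

namespace IsGeneralizedHopfOre

include h

theorem character_ι_one_eq_zero (hp : p.Prime)
    (hxy : LinearIndependent k ![pSum p (e 0) (e 1) α α', pSum p (e 0) (e 1) β β'])
    (hc1 : character τ (ι k (e 1)) ≠ 1) :
    character τ (ι k (e 1)) = 0 ∧ α 0 = 0 ∧ β 0 = 0 := by
  set c := character τ (ι k (e 1))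
  have he' : ⁅e 0, e 1⁆ = (1 : k) • e 0 := by rw [he, one_smul]
  have hcomm := h.comm_primitivityDefect (e 1)
  rw [primitivityDefect_ι_one he] at hcomm
  simp only [map_add, map_sub, map_smul, TensorProduct.comm_tmul] at hcomm
  have hsmul : (1 - c) • (α 0 • pSum p (e 0) (e 1) β β' - β 0 • pSum p (e 0) (e 1) α α') = 0 := by
    have key := congrArg (fun t => TensorProduct.lid k _ ((aCoord e he').rTensor _ t)) hcomm
    simp only [map_add, map_sub, map_smul, LinearMap.rTensor_tmul, TensorProduct.lid_tmul,
      aCoord_pSum hp, aCoord_ι_zero] at key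
    rw [← sub_eq_zero, ← neg_eq_zero] at key
    rw [← key]
    module
  have hprop := (smul_eq_zero.1 hsmul).resolve_left (sub_ne_zero.2 (Ne.symm hc1))
  obtain ⟨hβ, hα⟩ := eq_zero_of_smul_eq_smul hxy (sub_eq_zero.1 hprop).symm
  simp only [hα, hβ, zero_smul, add_zero, zero_sub, neg_inj] at hcomm
  exact ⟨eq_zero_of_smul_tmul_comm hxy hcomm.symm, hα, hβ⟩

theorem negSum_eq_zero (hp : p.Prime)
    (hxy : LinearIndependent k ![pSum p (e 0) (e 1) α α', pSum p (e 0) (e 1) β β'])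
    (hα : α 0 = 0) (hβ : β 0 = 0) : negSum α' = 0 ∧ negSum β' = 0 := by
  have he' : ⁅e 0, e 1⁆ = (1 : k) • e 0 := by rw [he, one_smul]
  have hcomm := h.comm_primitivityDefect (e 0)
  rw [primitivityDefect_ι_zero hp he] at hcomm
  have key := congrArg (fun t => TensorProduct.lid k _ ((aCoord e he').rTensor _ t)) hcomm
  simp only [map_add, map_smul, TensorProduct.comm_tmul, LinearMap.rTensor_tmul,
    TensorProduct.lid_tmul, aCoord_pSum hp, aCoord_ι_zero, hα, hβ, zero_smul, smul_zero, one_smul,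
    zero_add, add_zero] at key
  exact (eq_zero_of_smul_eq_smul hxy key).symm

theorem familyC (hp : p.Prime)
    (hxy : LinearIndependent k ![pSum p (e 0) (e 1) α α', pSum p (e 0) (e 1) β β'])
    (hc : character τ (ι k (e 1)) = 0) (hα : α 0 = 0) (hβ : β 0 = 0) :
    FamilyC p e (character τ) (pSum p (e 0) (e 1) α α') (pSum p (e 0) (e 1) β β') δ := by
  have he' : ⁅e 0, e 1⁆ = (1 : k) • e 0 := by rw [he, one_smul]
  have hc0 := character_ι_zero he τ
  obtain ⟨hα', hβ'⟩ := h.negSum_eq_zero he hp hxy hα hβ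
  have hδ0 : IsSkewPrimitive k 1 1 (δ (ι k (e 0))) :=
    h.isSkewPrimitive_δ (isSkewPrimitive_ι _) (by
      rw [primitivityDefect_ι_zero hp he, hα', hβ', zero_smul, zero_smul, add_zero])
  have hδ1 : IsSkewPrimitive k 1 1 (δ (ι k (e 1))) :=
    h.isSkewPrimitive_δ (isSkewPrimitive_ι _) (by
      rw [primitivityDefect_ι_one he, hc, hα, hβ, zero_smul, zero_smul, zero_smul, add_zero,
        sub_zero])
  refine ⟨he, fun v => ?_, hxy.ne_zero 0, hxy.ne_zero 1, span_singleton_ne hxy,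
    ⟨α, α', β, β', rfl, rfl, hα, hβ, hα', hβ'⟩, fun v => mem_hatL_of_primitive e he' hp ?_, ?_⟩
  · rw [ι_eq_smul_add_smul e, map_add, map_smul, map_smul, hc, hc0, smul_zero, smul_zero, add_zero]
  · rw [ι_eq_smul_add_smul e, map_add, map_smul, map_smul]
    exact (hδ0.smul _).add (hδ1.smul _)
  · simpa only [he, hc, hc0, zero_smul, add_zero, sub_zero] using h.δ_ι_lie (e 0) (e 1)

end IsGeneralizedHopfOre

theorem IsGeneralizedHopfOre.familyD (hp : p.Prime) (h2 : (2 : k) ≠ 0)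
    (h : IsGeneralizedHopfOre τ δ 1 1 (pSum p (e 0) (e 1) α α') (ι k (e 0)) i z)
    (hxa : LinearIndependent k ![pSum p (e 0) (e 1) α α', ι k (e 0)])
    (hα : α 0 = 0) (hc : character τ (ι k (e 1)) = 1) :
    FamilyD p e (character τ) (pSum p (e 0) (e 1) α α') (ι k (e 0)) δ := by
  have he' : ⁅e 0, e 1⁆ = (1 : k) • e 0 := by rw [he, one_smul]
  have ha := isSkewPrimitive_ι (k := k) (e 0)
  have hdefect0 := primitivityDefect_ι_zero hp he τ α α' (Finsupp.single 0 1) 0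
  have hdefect1 := primitivityDefect_ι_one he (p := p) 1 α α' (Finsupp.single 0 1) 0
  rw [pSum_single_zero] at hdefect0 hdefect1
  have hδ0 : IsSkewPrimitive k 1 1
      (δ (ι k (e 0)) - negSum α' • (2⁻¹ : k) • (ι k (e 0) * ι k (e 0))) := by
    rw [IsSkewPrimitive, map_sub, h.comul_δ_of_primitive ha, hdefect0, map_smul,
      comul_half_mul h2 ha ha rfl]
    simp only [negSum, Finsupp.sum_zero_index, TensorProduct.sub_tmul, TensorProduct.tmul_sub,
      ← TensorProduct.smul_tmul', TensorProduct.tmul_smul]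
    module
  have hδ1 : IsSkewPrimitive k 1 1 (δ (ι k (e 1))) := by
    refine h.isSkewPrimitive_δ (isSkewPrimitive_ι _) ?_
    rw [hc, hdefect1, hα, Finsupp.single_eq_same]
    module
  refine ⟨he, character_ι_zero he τ, hc, hxa.ne_zero 0, hxa.ne_zero 1, span_singleton_ne hxa, ?_,
    α, α', Finsupp.single 0 1, 0, rfl, (pSum_single_zero p e).symm, .inr (.inl ⟨?_, ?_, ?_⟩)⟩
  · have hrel := h.δ_ι_lie (e 0) (e 1)
    rw [he, hc, character_ι_zero he, zero_smul, one_smul, add_zero] at hrel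
    rw [two_smul, ← sub_eq_zero, ← sub_eq_zero.2 hrel]
    abel
  · rw [Finsupp.single_eq_same, one_smul]
  · rw [Finsupp.single_eq_same, mul_one, mul_comm, mul_smul, sq]
    exact mem_hatL_of_primitive e he' hp hδ0
  · rw [hα, mul_zero, zero_mul, zero_smul, sub_zero]
    exact mem_hatL_of_primitive e he' hp hδ1

variable {x y : 𝒰 k L}

theorem IsGeneralizedHopfOre.tmul_comm_of_character_eq_one
    (h : IsGeneralizedHopfOre τ δ 1 1 (pSum p (e 0) (e 1) α α') (pSum p (e 0) (e 1) β β') i z)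
    (hc : character τ (ι k (e 1)) = 1) :
    (pSum p (e 0) (e 1) α α' - α 0 • ι k (e 0)) ⊗ₜ[k]
        (pSum p (e 0) (e 1) β β' - β 0 • ι k (e 0)) =
      (pSum p (e 0) (e 1) β β' - β 0 • ι k (e 0)) ⊗ₜ[k]
        (pSum p (e 0) (e 1) α α' - α 0 • ι k (e 0)) := by
  have hcomm := h.comm_primitivityDefect (e 1)
  rw [primitivityDefect_ι_one he, hc] at hcomm
  simp only [map_add, map_sub, map_smul, TensorProduct.comm_tmul] at hcomm
  simp only [TensorProduct.sub_tmul, TensorProduct.tmul_sub, ← TensorProduct.smul_tmul',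
    TensorProduct.tmul_smul]
  rw [← sub_eq_zero] at hcomm ⊢
  rw [← hcomm]
  module

theorem IsGeneralizedHopfOre.hasNormalForm_of_character_eq_one (hp : p.Prime) (h2 : (2 : k) ≠ 0)
    (h : IsGeneralizedHopfOre τ δ 1 1 x y i z) (hx : IsSkewPrimitive k 1 1 x)
    (hy : IsSkewPrimitive k 1 1 y) (hxy : LinearIndependent k ![x, y])
    (hc : character τ (ι k (e 1)) = 1) : HasNormalForm p e i := by
  have he' : ⁅e 0, e 1⁆ = (1 : k) • e 0 := by rw [he, one_smul]
  have ha := isSkewPrimitive_ι (k := k) (e 0)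
  obtain ⟨α, α', rfl⟩ := exists_eq_pSum e he' hp hx
  obtain ⟨β, β', rfl⟩ := exists_eq_pSum e he' hp hy
  have hsymm := h.tmul_comm_of_character_eq_one he hc
  have hs := h.shift _ (comul_normalizer h2 hx hy ha hsymm)
  have hx' := (hx.smul (β 0)).sub (hy.smul (α 0))
  have hne : β 0 • pSum p (e 0) (e 1) α α' - α 0 • pSum p (e 0) (e 1) β β' ≠ 0 := by
    intro h0
    obtain ⟨hβ, hα⟩ := eq_zero_of_smul_eq_smul hxy (sub_eq_zero.1 h0)
    rw [hα, hβ, zero_smul, sub_zero, sub_zero] at hsymm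
    exact one_ne_zero (eq_zero_of_smul_tmul_comm hxy (congrArg ((1 : k) • ·) hsymm))
  have hcoord :
      aCoord e he' (β 0 • pSum p (e 0) (e 1) α α' - α 0 • pSum p (e 0) (e 1) β β') = 0 := by
    rw [map_sub, map_smul, map_smul, aCoord_pSum hp, aCoord_pSum hp, smul_eq_mul, smul_eq_mul,
      mul_comm, sub_self]
  obtain ⟨γ, γ', hγ⟩ := exists_eq_pSum e he' hp hx'
  rw [hγ] at hs hx' hne hcoord
  have hxa : LinearIndependent k ![pSum p (e 0) (e 1) γ γ', ι k (e 0)] := by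
    refine LinearIndependent.pair_iff.2 fun s t hst => ?_
    have ht : t = 0 := by
      simpa only [map_add, map_smul, hcoord, aCoord_ι_zero, smul_eq_mul, mul_zero, zero_add,
        mul_one, map_zero] using congrArg (aCoord e he') hst
    rw [ht, zero_smul, add_zero] at hst
    exact ⟨(smul_eq_zero.1 hst).resolve_right hne, ht⟩
  exact ⟨_, _, _, _, _, hs.isNormalHopfOre hx' ha (iff_of_false hne (hxa.ne_zero 1)),
    .inr (.inr (.inr (hs.familyD he hp h2 hxa (by rwa [aCoord_pSum hp] at hcoord) hc)))⟩

end Nonabelian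

theorem IsGeneralizedHopfOre.hasNormalForm_of_primitive (hp : p.Prime) (h2 : (2 : k) ≠ 0)
    (he : IsNormalBasis e) (h : IsGeneralizedHopfOre τ δ 1 1 x y i z)
    (hx : IsSkewPrimitive k 1 1 x) (hy : IsSkewPrimitive k 1 1 y) : HasNormalForm p e i := by
  by_cases hcomm : x ⊗ₜ[k] y = y ⊗ₜ[k] x
  · exact h.hasNormalForm_of_comul_eq hp he (comul_half_mul h2 hx hy hcomm)
  have hxy := linearIndependent_of_tmul_ne hcomm
  have hnormal := h.isNormalHopfOre hx hy (iff_of_false (hxy.ne_zero 0) (hxy.ne_zero 1))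
  rcases he with he | he
  · exact ⟨_, _, _, _, _, hnormal, .inr (.inl (h.familyB hp he hx hy hxy))⟩
  by_cases hc : character τ (ι k (e 1)) = 1
  · exact h.hasNormalForm_of_character_eq_one he hp h2 hx hy hxy hc
  obtain ⟨ε, he'⟩ := IsNormalBasis.exists_smul (.inr he)
  obtain ⟨α, α', rfl⟩ := exists_eq_pSum e he' hp hx
  obtain ⟨β, β', rfl⟩ := exists_eq_pSum e he' hp hy
  obtain ⟨hc, hα, hβ⟩ := h.character_ι_one_eq_zero he hp hxy hc
  exact ⟨_, _, _, _, _, hnormal, .inr (.inr (.inl (h.familyC he hp hxy hc hα hβ)))⟩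

theorem IsGeneralizedHopfOre.hasNormalForm (hp : p.Prime) (h2 : (2 : k) ≠ 0)
    (he : IsNormalBasis e) (h : IsGeneralizedHopfOre τ δ 1 1 x y i z) : HasNormalForm p e i := by
  obtain ⟨ε, he'⟩ := he.exists_smul
  rcases h.isTensorCocycle.primitive_or_scalar fun r hr => eq_one_of_groupLike e he' hr with
    ⟨hx, hy⟩ | ⟨c, hc⟩
  · exact h.hasNormalForm_of_primitive hp h2 he hx hy
  · refine h.hasNormalForm_of_comul_eq hp he (u := -(c • 1)) ?_
    rw [hc, map_neg, map_smul, Bialgebra.comul_one, Algebra.TensorProduct.one_def,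
      TensorProduct.neg_tmul, TensorProduct.tmul_neg, TensorProduct.smul_tmul',
      TensorProduct.tmul_smul, TensorProduct.smul_tmul']
    abel

end Classification

section OreGenerators

variable {k : Type u} [Field k] {L : Type v} [LieRing L] [LieAlgebra k L]

theorem relation_of_ι {R : Type*} [Ring R] [Algebra k R] {f : 𝒰 k L →ₐ[k] R} {t : R}
    {τ : 𝒰 k L →ₐ[k] 𝒰 k L} {δ : 𝒰 k L →ₗ[k] 𝒰 k L}
    (hδ : ∀ a b, δ (a * b) = τ a * δ b + δ a * b)
    (h : ∀ v : L, t * f (ι k v) = f (τ (ι k v)) * t + f (δ (ι k v))) (a : 𝒰 k L) :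
    t * f a = f (τ a) * t + f (δ a) := by
  have hδ1 : δ 1 = 0 := by simpa using hδ 1 1
  let S : Subalgebra k (𝒰 k L) :=
    { carrier := {a | t * f a = f (τ a) * t + f (δ a)}
      mul_mem' := fun {a b} (ha : t * f a = _) (hb : t * f b = _) => by
        rw [Set.mem_ofPred_eq, map_mul, ← mul_assoc, ha, add_mul, mul_assoc, hb, hδ]
        simp only [map_mul, map_add, mul_add, mul_assoc, add_assoc]
      add_mem' := fun {a b} (ha : t * f a = _) (hb : t * f b = _) => by
        rw [Set.mem_ofPred_eq, map_add, mul_add, ha, hb]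
        simp only [map_add, add_mul]
        abel
      algebraMap_mem' := fun c => by
        simp only [Set.mem_ofPred_eq, Algebra.algebraMap_eq_smul_one, map_smul, map_one, hδ1,
          smul_zero, map_zero, add_zero, mul_smul_comm, smul_mul_assoc, mul_one, one_mul] }
  exact mem_of_ι_mem k S h a

theorem oreMap_surjective {M : Type w} [LieRing M] [LieAlgebra k M] {f : 𝒰 k L →ₐ[k] 𝒰 k M}
    {t : 𝒰 k M} {τ δ : 𝒰 k L →ₗ[k] 𝒰 k L} (h : ∀ a, t * f a = f (τ a) * t + f (δ a))
    (hM : ∀ m : M, ∃ (a : 𝒰 k L) (c : k), ι k m = f a + c • t) :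
    Function.Surjective (oreMap f t) := by
  refine LinearMap.range_eq_top.1 (eq_top_iff.2 fun s _ =>
    mem_of_ι_mul_mem _ (one_mem_range_oreMap f t) (fun m r hr => ?_) s)
  obtain ⟨a, c, hm⟩ := hM m
  rw [hm, add_mul, smul_mul_assoc]
  exact add_mem (algHom_mul_mem_range_oreMap f t a hr)
    (Submodule.smul_mem _ c (mul_mem_range_oreMap h hr))

end OreGenerators

section EnvelopingLift

variable {k : Type u} [Field k] {H : Type w} [Ring H] [HopfAlgebra k H]

/-- The homomorphism of bialgebras `U(K) → H` induced by a Lie subalgebra `K` of `H` that consists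
of primitive elements. -/
def envLift (K : LieSubalgebra k H) (hK : ∀ t ∈ K, IsSkewPrimitive k 1 1 t) : 𝒰 k K →ₐc[k] H :=
  BialgHom.ofAlgHom (UniversalEnvelopingAlgebra.lift k K.incl)
    (env_hom_ext k fun t => by
      change Coalgebra.counit (R := k) (UniversalEnvelopingAlgebra.lift k _ (ι k t)) =
        envCounit k K (ι k t)
      rw [UniversalEnvelopingAlgebra.lift_ι_apply, envCounit_ι]
      exact (hK t t.2).counit_eq_zero)
    (env_hom_ext k fun t => by
      change Algebra.TensorProduct.map _ _ (envComul k K (ι k t)) =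
        Coalgebra.comul (R := k) (UniversalEnvelopingAlgebra.lift k _ (ι k t))
      simp only [envComul_ι, map_add, Algebra.TensorProduct.map_tmul, map_one,
        UniversalEnvelopingAlgebra.lift_ι_apply]
      exact (hK t t.2).symm)

theorem envLift_ι (K : LieSubalgebra k H) (hK : ∀ t ∈ K, IsSkewPrimitive k 1 1 t) (t : K) :
    envLift K hK (ι k t) = t :=
  UniversalEnvelopingAlgebra.lift_ι_apply k _ t

end EnvelopingLift

section OreIsEnveloping

variable {k : Type u} [Field k] {L : Type v} [LieRing L] [LieAlgebra k L] {H : Type w} [Ring H]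
  [HopfAlgebra k H] {τ : 𝒰 k L →ₐ[k] 𝒰 k L} {δ : 𝒰 k L →ₗ[k] 𝒰 k L} {i : 𝒰 k L →ₐc[k] H} {z : H}

/-- The map `(v, c) ↦ i(v) + cz`, whose image is the Lie algebra generated by `L` and `z` when
`δ(L) ⊆ L`. -/
def generatorMap (i : 𝒰 k L →ₐc[k] H) (z : H) : L × k →ₗ[k] H :=
  (AlgHom.toLinearMap (i : 𝒰 k L →ₐ[k] H) ∘ₗ (ι k : L →ₗ⁅k⁆ 𝒰 k L).toLinearMap).coprod
    (LinearMap.toSpanSingleton k H z)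

theorem generatorMap_apply (i : 𝒰 k L →ₐc[k] H) (z : H) (v : L) (c : k) :
    generatorMap i z (v, c) = i (ι k v) + c • z := rfl

theorem isSkewPrimitive_hom_ι (i : 𝒰 k L →ₐc[k] H) (v : L) :
    IsSkewPrimitive k 1 1 (i (ι k v)) := by
  rw [IsSkewPrimitive, comul_map, comul_ι]
  simp [-UniversalEnvelopingAlgebra.ι_apply]

theorem hom_ι_lie (i : 𝒰 k L →ₐc[k] H) (v w : L) :
    i (ι k ⁅v, w⁆) = i (ι k v) * i (ι k w) - i (ι k w) * i (ι k v) := by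
  rw [ι_lie, map_sub, map_mul, map_mul]

namespace IsGeneralizedHopfOre

variable (h : IsGeneralizedHopfOre τ δ 1 1 0 0 i z) (hδ : ∀ v : L, δ (ι k v) ∈ Set.range (ι k))

include h

theorem isSkewPrimitive_z : IsSkewPrimitive k 1 1 z := by
  simpa [IsSkewPrimitive] using h.comul_z

theorem z_mul_hom_ι (v : L) :
    z * i (ι k v) = i (ι k v) * z + character τ (ι k v) • z + i (δ (ι k v)) := by
  have hrel := h.ore.relation (ι k v)
  rw [h.τ_of_primitive (isSkewPrimitive_ι v), map_add, map_smul, map_one, add_mul,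
    smul_mul_assoc, one_mul] at hrel
  exact hrel

theorem generatorMap_injective (hL : Function.Injective (ι k : L → 𝒰 k L)) :
    Function.Injective (generatorMap i z) := by
  have hc1 (c : k) (hc : c • (1 : 𝒰 k L) = 0) : c = 0 := by
    simpa using congrArg (Coalgebra.counit (R := k)) hc
  refine (injective_iff_map_eq_zero _).2 ?_
  rintro ⟨v, c⟩ hvc
  rw [generatorMap_apply] at hvc
  have hv := congrArg (h.ore.coeff 0) hvc
  have hc := congrArg (h.ore.coeff 1) hvc
  rw [map_add, map_smul, h.coeff_zero_hom, h.coeff_zero_z, smul_zero, add_zero, map_zero] at hv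
  rw [map_add, map_smul, h.coeff_one_hom, h.coeff_one_z, zero_add, map_zero] at hc
  exact Prod.ext (hL (hv.trans (map_zero _).symm)) (hc1 c hc)

include hδ in
theorem lie_mem_range_generatorMap {s t : H} (hs : s ∈ LinearMap.range (generatorMap i z))
    (ht : t ∈ LinearMap.range (generatorMap i z)) :
    ⁅s, t⁆ ∈ LinearMap.range (generatorMap i z) := by
  obtain ⟨⟨v, c⟩, rfl⟩ := hs
  obtain ⟨⟨w, d⟩, rfl⟩ := ht
  obtain ⟨v', hv'⟩ := hδ v
  obtain ⟨w', hw'⟩ := hδ w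
  refine ⟨(⁅v, w⁆ + c • w' - d • v', c * character τ (ι k w) - d * character τ (ι k v)), ?_⟩
  simp only [generatorMap_apply, LieRing.of_associative_ring_bracket, add_mul, mul_add,
    smul_mul_assoc, mul_smul_comm, h.z_mul_hom_ι, map_add, map_sub, map_smul, hom_ι_lie, hv', hw']
  module

/-- The Lie subalgebra `i(L) + kz` of `H`. -/
def generatorAlgebra : LieSubalgebra k H where
  toSubmodule := LinearMap.range (generatorMap i z)
  lie_mem' := h.lie_mem_range_generatorMap hδ

theorem isSkewPrimitive_of_mem_generatorAlgebra :
    ∀ t ∈ h.generatorAlgebra hδ, IsSkewPrimitive k 1 1 t := by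
  rintro _ ⟨⟨v, c⟩, rfl⟩
  exact (isSkewPrimitive_hom_ι i v).add (h.isSkewPrimitive_z.smul c)

/-- The embedding of `L` into `i(L) + kz`. -/
def toGeneratorAlgebra : L →ₗ⁅k⁆ h.generatorAlgebra hδ where
  toFun v := ⟨i (ι k v), (v, 0), by rw [generatorMap_apply, zero_smul, add_zero]⟩
  map_add' v w := Subtype.ext (by simp only [map_add]; rfl)
  map_smul' c v := Subtype.ext (by simp only [map_smul]; rfl)
  map_lie' {v w} := Subtype.ext (hom_ι_lie i v w)

theorem z_mem_generatorAlgebra : z ∈ h.generatorAlgebra hδ :=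
  ⟨(0, 1), by rw [generatorMap_apply, map_zero, map_zero, zero_add, one_smul]⟩

theorem toGeneratorAlgebra_injective (hL : Function.Injective (ι k : L → 𝒰 k L)) :
    Function.Injective (h.toGeneratorAlgebra hδ) := by
  intro v w hvw
  have hi : i (ι k v) = i (ι k w) := congrArg Subtype.val hvw
  exact congrArg Prod.fst (h.generatorMap_injective hL (a₁ := (v, 0)) (a₂ := (w, 0)) (by
    rw [generatorMap_apply, generatorMap_apply, hi]))

/-- The homomorphism `U(L) → U(i(L) + kz)` induced by the embedding of `L`. -/
def envToGeneratorAlgebra : 𝒰 k L →ₐ[k] 𝒰 k (h.generatorAlgebra hδ) :=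
  UniversalEnvelopingAlgebra.lift k ((ι k).comp (h.toGeneratorAlgebra hδ))

theorem envToGeneratorAlgebra_ι (v : L) :
    h.envToGeneratorAlgebra hδ (ι k v) = ι k (h.toGeneratorAlgebra hδ v) :=
  UniversalEnvelopingAlgebra.lift_ι_apply k _ v

theorem envToGeneratorAlgebra_relation (a : 𝒰 k L) :
    ι k ⟨z, h.z_mem_generatorAlgebra hδ⟩ * h.envToGeneratorAlgebra hδ a =
      h.envToGeneratorAlgebra hδ (τ a) * ι k ⟨z, h.z_mem_generatorAlgebra hδ⟩ +
        h.envToGeneratorAlgebra hδ (δ a) := by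
  refine relation_of_ι h.ore.derivation (fun v => ?_) a
  obtain ⟨v', hv'⟩ := hδ v
  have hlie : ⁅(⟨z, h.z_mem_generatorAlgebra hδ⟩ : h.generatorAlgebra hδ),
      h.toGeneratorAlgebra hδ v⁆ = character τ (ι k v) • ⟨z, h.z_mem_generatorAlgebra hδ⟩ +
        h.toGeneratorAlgebra hδ v' := Subtype.ext (by
    change z * i (ι k v) - i (ι k v) * z = character τ (ι k v) • z + i (ι k v')
    rw [h.z_mul_hom_ι, hv']
    abel)
  have key := ι_lie (k := k) (⟨z, h.z_mem_generatorAlgebra hδ⟩ : h.generatorAlgebra hδ)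
    (h.toGeneratorAlgebra hδ v)
  rw [hlie, map_add, map_smul, eq_sub_iff_add_eq'] at key
  rw [h.τ_of_primitive (isSkewPrimitive_ι v), ← hv', map_add, map_smul, map_one,
    envToGeneratorAlgebra_ι, envToGeneratorAlgebra_ι, add_mul, smul_mul_assoc, one_mul, add_assoc,
    key]

theorem envLift_comp_envToGeneratorAlgebra :
    (envLift (h.generatorAlgebra hδ) (h.isSkewPrimitive_of_mem_generatorAlgebra hδ) :
      𝒰 k (h.generatorAlgebra hδ) →ₐ[k] H).comp (h.envToGeneratorAlgebra hδ) = i := by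
  refine env_hom_ext k fun v => ?_
  rw [AlgHom.comp_apply, envToGeneratorAlgebra_ι]
  exact envLift_ι _ (h.isSkewPrimitive_of_mem_generatorAlgebra hδ) _

theorem envLift_bijective : Function.Bijective
    (envLift (h.generatorAlgebra hδ) (h.isSkewPrimitive_of_mem_generatorAlgebra hδ)) := by
  have hsurj := oreMap_surjective (τ := τ.toLinearMap) (h.envToGeneratorAlgebra_relation hδ) (by
    rintro ⟨_, ⟨v, c⟩, rfl⟩
    exact ⟨ι k v, c, by rw [envToGeneratorAlgebra_ι, ← map_smul, ← map_add]; rfl⟩)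
  exact h.ore.bijective_of_comp hsurj (h.envLift_comp_envToGeneratorAlgebra hδ)
    (envLift_ι _ (h.isSkewPrimitive_of_mem_generatorAlgebra hδ) _)

end IsGeneralizedHopfOre

theorem IsNormalHopfOre.exists_enveloping [Module.Finite k L] {χ : 𝒰 k L →ₐ[k] k}
    (hL : Function.Injective (ι k : L → 𝒰 k L)) (h : IsNormalHopfOre χ 1 1 0 0 δ i z)
    (hδ : ∀ v : L, δ (ι k v) ∈ Set.range (ι k)) :
    ∃ (M : Type w) (_ : LieRing M) (_ : LieAlgebra k M),
      Module.finrank k M = Module.finrank k L + 1 ∧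
        (∃ N : LieSubalgebra k M, Module.finrank k N = Module.finrank k L) ∧
        Nonempty (𝒰 k M ≃ₐc[k] H) := by
  obtain ⟨τ, _, h⟩ := h.extension
  refine ⟨h.generatorAlgebra hδ, inferInstance, inferInstance, ?_,
    ⟨(h.toGeneratorAlgebra hδ).range, ?_⟩, ⟨BialgEquiv.ofBijective _ (h.envLift_bijective hδ)⟩⟩
  · rw [← Module.finrank_self k, ← Module.finrank_prod]
    exact (LinearEquiv.ofInjective _ (h.generatorMap_injective hL)).finrank_eq.symm
  · exact (LinearEquiv.ofInjective
      (f := (h.toGeneratorAlgebra hδ : L →ₗ[k] h.generatorAlgebra hδ))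
      (h.toGeneratorAlgebra_injective hδ hL)).finrank_eq.symm

end OreIsEnveloping

section TwoDimensional

variable {k : Type u} [Field k] {L : Type v} [LieRing L] [LieAlgebra k L]

theorem ι_injective (e : Module.Basis (Fin 2) k L) {ε : k} (he : ⁅e 0, e 1⁆ = ε • e 0) :
    Function.Injective (ι k : L → 𝒰 k L) := by
  have hli : LinearIndependent k fun j => (ι k : L →ₗ⁅k⁆ 𝒰 k L).toLinearMap (e j) := by
    convert (pbwBasis e he).linearIndependent.comp ![(0, 1), (1, 0)] (by decide) using 1
    funext j
    fin_cases j <;> simp [pbwBasis_apply, -UniversalEnvelopingAlgebra.ι_apply]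
  have hconstr := e.injective_constr_of_linearIndependent (R₂ := k) hli
  rwa [e.constr_self] at hconstr

theorem exists_lie_eq_self (e : Module.Basis (Fin 2) k L) (h : ⁅e 0, e 1⁆ ≠ 0) :
    ∃ s : L, ⁅⁅e 0, e 1⁆, s⁆ = ⁅e 0, e 1⁆ := by
  by_cases h0 : e.repr ⁅e 0, e 1⁆ 0 = 0
  · have h1 : e.repr ⁅e 0, e 1⁆ 1 ≠ 0 := fun h1 =>
      h <| e.ext_elem fun j => by fin_cases j <;> simp [h0, h1]
    refine ⟨-(e.repr ⁅e 0, e 1⁆ 1)⁻¹ • e 0, ?_⟩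
    rw [lie_eq_smul_lie e, map_smul, e.repr_self, h0]
    simp [h1]
  · refine ⟨(e.repr ⁅e 0, e 1⁆ 0)⁻¹ • e 1, ?_⟩
    rw [lie_eq_smul_lie e, map_smul, e.repr_self]
    simp [h0]

theorem exists_isNormalBasis (hL : Module.finrank k L = 2) :
    ∃ e : Module.Basis (Fin 2) k L, IsNormalBasis e := by
  have := Module.finite_of_finrank_pos (by omega : 0 < Module.finrank k L)
  let e := Module.finBasisOfFinrankEq k L hL
  by_cases h : ⁅e 0, e 1⁆ = 0
  · exact ⟨e, Or.inl h⟩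
  obtain ⟨s, hs⟩ := exists_lie_eq_self e h
  have hli : LinearIndependent k ![⁅e 0, e 1⁆, s] := by
    refine LinearIndependent.pair_iff.2 fun c d hcd => ?_
    have hd : d • ⁅e 0, e 1⁆ = 0 := by
      simpa only [lie_add, lie_smul, lie_self, smul_zero, zero_add, hs, lie_zero] using
        congrArg (⁅⁅e 0, e 1⁆, ·⁆) hcd
    have hd := (smul_eq_zero.1 hd).resolve_right h
    rw [hd, zero_smul, add_zero] at hcd
    exact ⟨(smul_eq_zero.1 hcd).resolve_right h, hd⟩
  refine ⟨basisOfLinearIndependentOfCardEqFinrank hli (by rw [hL, Fintype.card_fin]), Or.inr ?_⟩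
  simp [hs]

end TwoDimensional

section TwistedDerivation

variable {k : Type u} [Field k] {L : Type v} [LieRing L] [LieAlgebra k L]

/-- The algebra endomorphism `a ↦ ∑ χ(a₁) a₂` of `U(L)`. -/
def twistHom (χ : 𝒰 k L →ₐ[k] k) : 𝒰 k L →ₐ[k] 𝒰 k L :=
  (Algebra.TensorProduct.lid k _).toAlgHom.comp
    ((Algebra.TensorProduct.map χ (AlgHom.id k _)).comp (Bialgebra.comulAlgHom k _))

theorem twistHom_toLinearMap (χ : 𝒰 k L →ₐ[k] k) : (twistHom χ).toLinearMap = twist χ 1 :=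
  LinearMap.ext fun a => (twist_one_apply χ a).symm

theorem twistHom_ι (χ : 𝒰 k L →ₐ[k] k) (v : L) : twistHom χ (ι k v) = ι k v + χ (ι k v) • 1 :=
  (LinearMap.congr_fun (twistHom_toLinearMap χ) _).trans
    (twist_one_of_primitive χ (isSkewPrimitive_ι v))

variable (τ : 𝒰 k L →ₐ[k] 𝒰 k L) (d : L →ₗ[k] 𝒰 k L)
  (hd : ∀ v w : L, d ⁅v, w⁆ =
    τ (ι k v) * d w + d v * ι k w - (τ (ι k w) * d v + d w * ι k v))

/-- A map `δ` is a `τ`-derivation if and only if the matrices with rows `τ(a), δ(a)` and `0, a`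
multiply like the elements `a`. This is the representation of `L` by such matrices that belongs to
the restriction `d` of `δ` to `L`. -/
def triangularRep : L →ₗ⁅k⁆ Matrix (Fin 2) (Fin 2) (𝒰 k L) where
  toFun v := !![τ (ι k v), d v; 0, ι k v]
  map_add' v w := by simp [-UniversalEnvelopingAlgebra.ι_apply]
  map_smul' c v := by simp [-UniversalEnvelopingAlgebra.ι_apply]
  map_lie' {v w} := by
    rw [LieRing.of_associative_ring_bracket, Matrix.mul_fin_two, Matrix.mul_fin_two, hd, ι_lie,
      map_sub, map_mul, map_mul]
    simp [-UniversalEnvelopingAlgebra.ι_apply]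

/-- The `τ`-derivation of `U(L)` that extends the linear map `d` on `L`. -/
def extendDerivation : 𝒰 k L →ₗ[k] 𝒰 k L :=
  Matrix.entryLinearMap k (𝒰 k L) 0 1 ∘ₗ
    (UniversalEnvelopingAlgebra.lift k (triangularRep τ d hd)).toLinearMap

theorem lift_triangularRep (a : 𝒰 k L) :
    UniversalEnvelopingAlgebra.lift k (triangularRep τ d hd) a =
      !![τ a, extendDerivation τ d hd a; 0, a] := by
  set ρ := UniversalEnvelopingAlgebra.lift k (triangularRep τ d hd)
  let S : Subalgebra k (𝒰 k L) :=
    { carrier := {a | ρ a 0 0 = τ a ∧ ρ a 1 0 = 0 ∧ ρ a 1 1 = a}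
      mul_mem' := by
        rintro a b ⟨h₁, h₂, h₃⟩ ⟨h₁', h₂', h₃'⟩
        simp [Matrix.mul_apply, h₁, h₂, h₃, h₁', h₂', h₃']
      add_mem' := by
        rintro a b ⟨h₁, h₂, h₃⟩ ⟨h₁', h₂', h₃'⟩
        simp [h₁, h₂, h₃, h₁', h₂', h₃']
      algebraMap_mem' := fun c => by simp [Matrix.algebraMap_matrix_apply] }
  obtain ⟨h₁, h₂, h₃⟩ := mem_of_ι_mem k S (fun v => by
    change ρ _ 0 0 = _ ∧ ρ _ 1 0 = 0 ∧ ρ _ 1 1 = _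
    rw [UniversalEnvelopingAlgebra.lift_ι_apply]
    exact ⟨rfl, rfl, rfl⟩) a
  rw [Matrix.eta_fin_two (ρ a), h₁, h₂, h₃]
  rfl

theorem extendDerivation_mul (a b : 𝒰 k L) : extendDerivation τ d hd (a * b) =
    τ a * extendDerivation τ d hd b + extendDerivation τ d hd a * b := by
  have h := map_mul (UniversalEnvelopingAlgebra.lift k (triangularRep τ d hd)) a b
  simp only [lift_triangularRep, Matrix.mul_fin_two] at h
  exact congrFun (congrFun h 0) 1

theorem extendDerivation_ι (v : L) : extendDerivation τ d hd (ι k v) = d v := by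
  change UniversalEnvelopingAlgebra.lift k (triangularRep τ d hd) (ι k v) 0 1 = d v
  rw [UniversalEnvelopingAlgebra.lift_ι_apply]
  rfl

theorem oreOp_mul_lsmul {A : Type*} [Ring A] [Algebra k A] {τ : A →ₐ[k] A} {δ : A →ₗ[k] A}
    (hδ : ∀ a b, δ (a * b) = τ a * δ b + δ a * b) (a : A) :
    oreOp τ.toLinearMap δ * Algebra.lsmul k k (ℕ →₀ A) a =
      Algebra.lsmul k k (ℕ →₀ A) (τ a) * oreOp τ.toLinearMap δ +
        Algebra.lsmul k k (ℕ →₀ A) (δ a) := by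
  refine Finsupp.lhom_ext fun n b => ?_
  simp only [LinearMap.add_apply, Module.End.mul_apply, Algebra.lsmul_coe, Finsupp.smul_single,
    smul_eq_mul, oreOp_single, hδ, smul_add, AlgHom.toLinearMap_apply, map_mul, Finsupp.single_add]
  abel

end TwistedDerivation

section Codimension

variable {k : Type u} [Field k] {M : Type v} [LieRing M] [LieAlgebra k M]

/-- A decomposition `M = N ⊕ km`, given by `m` and the functional with kernel `N` and value `1` at
`m`. -/
structure LineComplement (N : LieSubalgebra k M) where
  vec : M
  coord : M →ₗ[k] k
  coord_vec : coord vec = 1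
  coord_eq_zero_iff : ∀ t, coord t = 0 ↔ t ∈ N

variable {N : LieSubalgebra k M}

theorem nonempty_lineComplement (hN : Module.finrank k M = Module.finrank k N + 1) :
    Nonempty (LineComplement N) := by
  have := Module.finite_of_finrank_pos (by omega : 0 < Module.finrank k M)
  have hquot : Module.finrank k (M ⧸ N.toSubmodule) = 1 := by
    have hsum : _ + Module.finrank k N = _ := N.toSubmodule.finrank_quotient_add_finrank
    omega
  obtain ⟨g⟩ := Module.nonempty_linearEquiv_of_finrank_eq_one hquot
  obtain ⟨m, hm⟩ := N.toSubmodule.mkQ_surjective (g 1)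
  exact ⟨⟨m, g.symm.toLinearMap ∘ₗ N.toSubmodule.mkQ, by simp [hm], fun t => by simp⟩⟩

namespace LineComplement

variable (D : LineComplement N)

theorem coord_coe (v : N) : D.coord v = 0 := (D.coord_eq_zero_iff v).2 v.2

/-- The projection to `N` along `m`. -/
def proj : M →ₗ[k] N :=
  LinearMap.codRestrict N.toSubmodule
    (LinearMap.id - LinearMap.toSpanSingleton k M D.vec ∘ₗ D.coord) fun t =>
      (D.coord_eq_zero_iff _).1 (by simp [D.coord_vec])

theorem coe_proj (t : M) : (D.proj t : M) = t - D.coord t • D.vec := rfl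

theorem proj_add_coord_smul (t : M) : (D.proj t : M) + D.coord t • D.vec = t := by
  rw [coe_proj, sub_add_cancel]

theorem proj_coe (v : N) : D.proj v = v :=
  Subtype.ext (by rw [coe_proj, coord_coe, zero_smul, sub_zero])

theorem proj_vec : D.proj D.vec = 0 :=
  Subtype.ext (by rw [coe_proj, coord_vec, one_smul, sub_self, ZeroMemClass.coe_zero])

/-- The `N`-component of `[m, v]` for `v ∈ N`. -/
def lieProj : N →ₗ[k] N := D.proj ∘ₗ (LieAlgebra.ad k M D.vec : M →ₗ[k] M) ∘ₗ N.toSubmodule.subtype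

/-- The coefficient of `m` in `[m, v]` for `v ∈ N`. -/
def lieCoord : N →ₗ[k] k :=
  D.coord ∘ₗ (LieAlgebra.ad k M D.vec : M →ₗ[k] M) ∘ₗ N.toSubmodule.subtype

theorem lie_vec_coe (v : N) : ⁅D.vec, (v : M)⁆ = D.lieProj v + D.lieCoord v • D.vec :=
  (D.proj_add_coord_smul ⁅D.vec, (v : M)⁆).symm

theorem lie_coe_vec (v : N) : ⁅(v : M), D.vec⁆ = -(D.lieProj v + D.lieCoord v • D.vec) := by
  rw [← lie_vec_coe, lie_skew]

/-- The Jacobi identity for `m`, `v` and `w`. -/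
theorem lieProj_lie_add (v w : N) : (D.lieProj ⁅v, w⁆ : M) + D.lieCoord ⁅v, w⁆ • D.vec =
    (⁅D.lieProj v, w⁆ + ⁅v, D.lieProj w⁆ + D.lieCoord v • D.lieProj w -
      D.lieCoord w • D.lieProj v : N) := by
  rw [← lie_vec_coe, LieSubalgebra.coe_bracket, leibniz_lie, lie_vec_coe, lie_vec_coe]
  simp only [add_lie, lie_add, smul_lie, lie_smul, lie_vec_coe, lie_coe_vec, AddMemClass.coe_add,
    AddSubgroupClass.coe_sub, SetLike.val_smul, LieSubalgebra.coe_bracket]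
  module

theorem lieCoord_lie (v w : N) : D.lieCoord ⁅v, w⁆ = 0 := by
  simpa only [map_add, coord_coe, map_smul, coord_vec, zero_add, smul_eq_mul, mul_one] using
    congrArg D.coord (D.lieProj_lie_add v w)

theorem lieProj_lie (v w : N) : D.lieProj ⁅v, w⁆ = ⁅D.lieProj v, w⁆ + ⁅v, D.lieProj w⁆ +
    D.lieCoord v • D.lieProj w - D.lieCoord w • D.lieProj v :=
  Subtype.ext <| by
    simpa only [lieCoord_lie, zero_smul, add_zero] using D.lieProj_lie_add v w

theorem lie_eq (s t : M) : ⁅s, t⁆ =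
    (⁅D.proj s, D.proj t⁆ + D.coord s • D.lieProj (D.proj t) -
      D.coord t • D.lieProj (D.proj s) : N) +
      (D.coord s * D.lieCoord (D.proj t) - D.coord t * D.lieCoord (D.proj s)) • D.vec := by
  conv_lhs => rw [← D.proj_add_coord_smul s, ← D.proj_add_coord_smul t]
  simp only [add_lie, lie_add, smul_lie, lie_smul, lie_self, lie_vec_coe, lie_coe_vec,
    AddMemClass.coe_add, AddSubgroupClass.coe_sub, SetLike.val_smul, LieSubalgebra.coe_bracket]
  module

/-- The character of `U(N)` that describes the twist when `m` moves past elements of `N`. -/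
def char : 𝒰 k N →ₐ[k] k :=
  UniversalEnvelopingAlgebra.lift k
    { D.lieCoord with
      map_lie' := fun {v w} => (D.lieCoord_lie v w).trans
        (by rw [LieRing.of_associative_ring_bracket, mul_comm, sub_self]) }

theorem char_ι (v : N) : D.char (ι k v) = D.lieCoord v :=
  UniversalEnvelopingAlgebra.lift_ι_apply k _ v

/-- The twisted derivation of `U(N)` that extends `v ↦ [m, v]`, up to multiples of `m`. -/
def der : 𝒰 k N →ₗ[k] 𝒰 k N :=
  extendDerivation (twistHom D.char) ((ι k : N →ₗ⁅k⁆ 𝒰 k N).toLinearMap ∘ₗ D.lieProj)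
    fun v w => by
      change ι k (D.lieProj ⁅v, w⁆) = _ * ι k (D.lieProj w) + ι k (D.lieProj v) * _ -
        (_ * ι k (D.lieProj v) + ι k (D.lieProj w) * _)
      simp only [lieProj_lie, twistHom_ι, char_ι, map_add, map_sub, map_smul, ι_lie, add_mul,
        smul_mul_assoc, one_mul]
      abel

theorem der_mul (a b : 𝒰 k N) : D.der (a * b) = twistHom D.char a * D.der b + D.der a * b :=
  extendDerivation_mul _ _ _ a b

theorem der_ι (v : N) : D.der (ι k v) = ι k (D.lieProj v) :=
  extendDerivation_ι _ _ _ v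

theorem envIncl_ι (v : N) : (envIncl k M N : 𝒰 k N →ₐ[k] 𝒰 k M) (ι k v) = ι k (v : M) :=
  UniversalEnvelopingAlgebra.lift_ι_apply k _ v

theorem ι_vec_mul_envIncl (a : 𝒰 k N) :
    ι k D.vec * (envIncl k M N : 𝒰 k N →ₐ[k] 𝒰 k M) a =
      (envIncl k M N : 𝒰 k N →ₐ[k] 𝒰 k M) (twistHom D.char a) * ι k D.vec +
        (envIncl k M N : 𝒰 k N →ₐ[k] 𝒰 k M) (D.der a) := by
  refine relation_of_ι (f := (envIncl k M N : 𝒰 k N →ₐ[k] 𝒰 k M)) D.der_mul (fun v => ?_) a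
  have h := ι_lie (k := k) D.vec (v : M)
  rw [lie_vec_coe, map_add, map_smul, eq_sub_iff_add_eq] at h
  rw [twistHom_ι, der_ι, char_ι, map_add, map_smul, map_one, envIncl_ι, envIncl_ι, add_mul,
    smul_mul_assoc, one_mul, ← h]
  abel

/-- The operator by which `m` acts on `U(N)[z]`. -/
abbrev vecOp : Module.End k (ℕ →₀ 𝒰 k N) := oreOp (twistHom D.char).toLinearMap D.der

theorem vecOp_mul_lsmul_ι (v : N) : D.vecOp * Algebra.lsmul k k (ℕ →₀ 𝒰 k N) (ι k v) =
    Algebra.lsmul k k _ (ι k v) * D.vecOp +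
      (D.lieCoord v • D.vecOp + Algebra.lsmul k k _ (ι k (D.lieProj v))) := by
  rw [oreOp_mul_lsmul D.der_mul, twistHom_ι, der_ι, char_ι, map_add, map_smul, map_one, add_mul,
    smul_mul_assoc, one_mul, add_assoc]

/-- The action of `M` on `U(N)[z]` that `M` would have by left multiplication on `U(M)`, if the
powers of `m` were a basis of `U(M)` over `U(N)`. -/
def actionMap : M →ₗ[k] Module.End k (ℕ →₀ 𝒰 k N) :=
  (Algebra.lsmul k k (ℕ →₀ 𝒰 k N)).toLinearMap ∘ₗ (ι k : N →ₗ⁅k⁆ 𝒰 k N).toLinearMap ∘ₗ D.proj +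
    LinearMap.toSpanSingleton k _ D.vecOp ∘ₗ D.coord

theorem actionMap_apply (t : M) : D.actionMap t =
    Algebra.lsmul k k _ (ι k (D.proj t)) + D.coord t • D.vecOp := rfl

theorem actionMap_vec : D.actionMap D.vec = D.vecOp := by
  rw [actionMap_apply, proj_vec, coord_vec, map_zero, map_zero, one_smul, zero_add]

theorem actionMap_coe (v : N) : D.actionMap v = Algebra.lsmul k k _ (ι k v) := by
  rw [actionMap_apply, proj_coe, coord_coe, zero_smul, add_zero]

theorem actionMap_lie (s t : M) :
    D.actionMap ⁅s, t⁆ = D.actionMap s * D.actionMap t - D.actionMap t * D.actionMap s := by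
  rw [D.lie_eq s t, map_add, map_smul, actionMap_vec, actionMap_coe, actionMap_apply D s,
    actionMap_apply D t]
  simp only [add_mul, mul_add, smul_mul_assoc, mul_smul_comm, vecOp_mul_lsmul_ι, map_add, map_sub,
    map_smul, ι_lie, map_mul]
  module

/-- The representation of `U(M)` on `U(N)[z]` in which `m` acts as `z`. -/
def action : 𝒰 k M →ₐ[k] Module.End k (ℕ →₀ 𝒰 k N) :=
  UniversalEnvelopingAlgebra.lift k { D.actionMap with map_lie' := D.actionMap_lie _ _ }

theorem action_ι (t : M) : D.action (ι k t) = D.actionMap t :=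
  UniversalEnvelopingAlgebra.lift_ι_apply k _ t

theorem action_envIncl (a : 𝒰 k N) :
    D.action ((envIncl k M N : 𝒰 k N →ₐ[k] 𝒰 k M) a) = Algebra.lsmul k k (ℕ →₀ 𝒰 k N) a :=
  mem_of_ι_mem k (AlgHom.equalizer (D.action.comp (envIncl k M N : 𝒰 k N →ₐ[k] 𝒰 k M))
    (Algebra.lsmul k k (ℕ →₀ 𝒰 k N))) (fun v => by
      rw [AlgHom.mem_equalizer, AlgHom.comp_apply, envIncl_ι, action_ι, actionMap_coe]) a

theorem isOreExtension :
    IsOreExtension (twistHom D.char) D.der (envIncl k M N : 𝒰 k N →ₐ[k] 𝒰 k M) (ι k D.vec) where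
  derivation := D.der_mul
  relation := D.ι_vec_mul_envIncl
  basis := by
    have hδ : D.der 1 = 0 := by simpa using D.der_mul 1 1
    have hspan (t : M) : ∃ (a : 𝒰 k N) (c : k),
        ι k t = (envIncl k M N : 𝒰 k N →ₐ[k] 𝒰 k M) a + c • ι k D.vec :=
      ⟨ι k (D.proj t), D.coord t, by
        rw [envIncl_ι, ← map_smul, ← map_add, proj_add_coord_smul]⟩
    exact ⟨oreMap_injective_of_action (map_one (twistHom D.char)) hδ D.action
        (fun a f => LinearMap.congr_fun (D.action_envIncl a) f) (by rw [action_ι, actionMap_vec]),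
      oreMap_surjective (τ := (twistHom D.char).toLinearMap) D.ι_vec_mul_envIncl hspan⟩

theorem isNormalHopfOre :
    IsNormalHopfOre D.char 1 1 0 0 D.der (envIncl k M N) (ι k D.vec) where
  extension := ⟨twistHom D.char, twistHom_toLinearMap D.char, D.isOreExtension, by
    rw [comul_ι]
    simp [-UniversalEnvelopingAlgebra.ι_apply]⟩
  groupLike₁ := IsGroupLikeElem.one
  groupLike₂ := IsGroupLikeElem.one
  primitive_x := isSkewPrimitive_zero _ _
  primitive_y := isSkewPrimitive_zero _ _
  zero_iff := Iff.rfl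

theorem der_ι_mem_range (v : N) : D.der (ι k v) ∈ Set.range (ι k : N → 𝒰 k N) :=
  ⟨D.lieProj v, (D.der_ι v).symm⟩

theorem familyA (p : ℕ) {e : Module.Basis (Fin 2) k N} (he : IsNormalBasis e) :
    FamilyA p e D.char 0 0 D.der := by
  refine ⟨he, rfl, rfl, fun v => ?_, ?_⟩
  · rw [der_ι]
    exact Submodule.subset_span ⟨D.lieProj v, 0, by rw [pow_zero, pow_one]⟩
  · simp only [der_ι, char_ι, lieProj_lie, map_add, map_sub, map_smul, opComm_ι]

end LineComplement

end Codimension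

theorem IsSkewPrimitive.existsUnique_pSum {k : Type u} [Field k] {L : Type v} [LieRing L]
    [LieAlgebra k L] {p : ℕ} [CharP k p] (hp : p.Prime) {e : Module.Basis (Fin 2) k L}
    (he : IsNormalBasis e) {x : 𝒰 k L} (h : IsSkewPrimitive k 1 1 x) :
    ∃! c : (ℕ →₀ k) × (ℕ →₀ k), x = pSum p (e 0) (e 1) c.1 c.2 := by
  obtain ⟨ε, he⟩ := he.exists_smul
  obtain ⟨α, α', hx⟩ := exists_eq_pSum e he hp h
  exact ⟨(α, α'), hx, fun c hc =>
    Prod.ext_iff.2 (pSum_injective e he hp (hc.symm.trans hx))⟩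

end

end HopfOre

theorem proposition2p12 {k : Type u} [Field k] (p : ℕ) [CharP k p] (hp : 2 < p)
    {L : Type v} [LieRing L] [LieAlgebra k L] (hL : Module.finrank k L = 2) :
    -- there is a basis `a, b` with `[a, b] = 0` or `[a, b] = a`
    (∃ e : Module.Basis (Fin 2) k L, IsNormalBasis e) ∧
    -- every generalized Hopf-Ore extension `H` of `U(L)`
    (∀ {H : Type w} [Ring H] [HopfAlgebra k H]
      (τ : UniversalEnvelopingAlgebra k L →ₐ[k] UniversalEnvelopingAlgebra k L)
      (δ : UniversalEnvelopingAlgebra k L →ₗ[k] UniversalEnvelopingAlgebra k L)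
      (r₁ r₂ x y : UniversalEnvelopingAlgebra k L)
      (i : UniversalEnvelopingAlgebra k L →ₐc[k] H) (z : H),
      IsGeneralizedHopfOre τ δ r₁ r₂ x y i z →
        r₁ = 1 ∧ r₂ = 1 ∧
        -- if `x` and `y` are normalized to be skew-primitive
        (IsSkewPrimitive k 1 r₂ x → IsSkewPrimitive k r₁ 1 y →
          x ∈ hatL p k L ∧ y ∈ hatL p k L ∧
          ∀ e : Module.Basis (Fin 2) k L, IsNormalBasis e →
            (∃! c : (ℕ →₀ k) × (ℕ →₀ k), x = pSum p (e 0) (e 1) c.1 c.2) ∧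
            (∃! c : (ℕ →₀ k) × (ℕ →₀ k), y = pSum p (e 0) (e 1) c.1 c.2)) ∧
        -- the classification
        ∀ e : Module.Basis (Fin 2) k L, IsNormalBasis e →
          ∃ (H' : Type w) (_ : Ring H') (_ : HopfAlgebra k H')
            (χ : UniversalEnvelopingAlgebra k L →ₐ[k] k)
            (x' y' : UniversalEnvelopingAlgebra k L)
            (δ' : UniversalEnvelopingAlgebra k L →ₗ[k] UniversalEnvelopingAlgebra k L)
            (i' : UniversalEnvelopingAlgebra k L →ₐc[k] H') (z' : H'),
            IsNormalHopfOre χ 1 1 x' y' δ' i' z' ∧ InList p e χ x' y' δ' ∧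
              ExtensionIso i i') ∧
    -- the members of family (a) with `δ(L) ⊆ L` are enveloping algebras of 3-dimensional Lie
    -- algebras with a 2-dimensional subalgebra
    (∀ {H : Type w} [Ring H] [HopfAlgebra k H] (e : Module.Basis (Fin 2) k L)
      (χ : UniversalEnvelopingAlgebra k L →ₐ[k] k)
      (δ : UniversalEnvelopingAlgebra k L →ₗ[k] UniversalEnvelopingAlgebra k L)
      (i : UniversalEnvelopingAlgebra k L →ₐc[k] H) (z : H),
      IsNormalHopfOre χ 1 1 0 0 δ i z → FamilyA p e χ 0 0 δ →
      (∀ v : L, δ (UniversalEnvelopingAlgebra.ι k v) ∈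
        Set.range (UniversalEnvelopingAlgebra.ι k (L := L))) →
      ∃ (M : Type w) (_ : LieRing M) (_ : LieAlgebra k M),
        Module.finrank k M = 3 ∧ (∃ N : LieSubalgebra k M, Module.finrank k N = 2) ∧
        Nonempty (UniversalEnvelopingAlgebra k M ≃ₐc[k] H)) ∧
    -- and all of these enveloping algebras arise so
    (∀ {M : Type v} [LieRing M] [LieAlgebra k M] (N : LieSubalgebra k M),
      Module.finrank k M = 3 → Module.finrank k N = 2 →
      ∃ (e : Module.Basis (Fin 2) k N)
        (χ : UniversalEnvelopingAlgebra k N →ₐ[k] k)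
        (δ : UniversalEnvelopingAlgebra k N →ₗ[k] UniversalEnvelopingAlgebra k N)
        (z : UniversalEnvelopingAlgebra k M),
        IsNormalHopfOre χ 1 1 0 0 δ (envIncl k M N) z ∧ FamilyA p e χ 0 0 δ ∧
        ∀ v : N, δ (UniversalEnvelopingAlgebra.ι k v) ∈
          Set.range (UniversalEnvelopingAlgebra.ι k (L := N))) := by
  have hp' : p.Prime := (CharP.char_is_prime_or_zero k p).resolve_right (by omega)
  have h2 : (2 : k) ≠ 0 := fun h =>
    absurd (Nat.le_of_dvd two_pos ((CharP.cast_eq_zero_iff k p 2).1 (by exact_mod_cast h)))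
      (by omega)
  obtain ⟨e₀, he₀⟩ := exists_isNormalBasis hL
  obtain ⟨ε, hε⟩ := he₀.exists_smul
  refine ⟨⟨e₀, he₀⟩, ?_, ?_, ?_⟩
  · intro H _ _ τ δ r₁ r₂ x y i z h
    obtain rfl : r₁ = 1 := eq_one_of_groupLike e₀ hε h.isGroupLikeElem_r₁
    obtain rfl : r₂ = 1 := eq_one_of_groupLike e₀ hε h.isGroupLikeElem_r₂
    refine ⟨rfl, rfl, fun hx hy => ⟨mem_hatL_of_primitive e₀ hε hp' hx,
      mem_hatL_of_primitive e₀ hε hp' hy, fun e he =>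
        ⟨hx.existsUnique_pSum hp' he, hy.existsUnique_pSum hp' he⟩⟩, fun e he => ?_⟩
    obtain ⟨χ, x', y', δ', z', hnormal, hlist⟩ := h.hasNormalForm hp' h2 he
    exact ⟨H, _, _, χ, x', y', δ', i, z', hnormal, hlist, BialgEquiv.refl k H, by simp⟩
  · intro H _ _ e χ δ i z h _ hδ
    have := Module.finite_of_finrank_pos (by omega : 0 < Module.finrank k L)
    simpa only [hL] using h.exists_enveloping (ι_injective e₀ hε) hδ
  · intro M _ _ N hM hN
    obtain ⟨D⟩ := nonempty_lineComplement (N := N) (by omega)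
    obtain ⟨e, he⟩ := exists_isNormalBasis hN
    exact ⟨e, D.char, D.der, _, D.isNormalHopfOre, D.familyA p he, D.der_ι_mem_range⟩
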